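/- Let $H$ be a complex Hilbert space (of any dimension), $\rho$ a density operator on $H$ (positive, trace class, $\mathrm{tr}\,\rho=1$) and $m\ge 1$. Inner products are linear in the second variable. Put $\mathcal H=H^{\otimes m}$ (Hilbert space tensor product). For homogeneous histories, i.e. $h=h_1\otimes\cdots\otimes h_m$ and $k=k_1\otimes\cdots\otimes k_m$ with projections $h_i,k_i$ on $H$ (in the Heisenberg picture), the standard decoherence functional is $$d_\rho(h,k)=\mathrm{tr}(h_m\cdots h_1\,\rho\,k_1\cdots k_m).$$ Given orthonormal bases $(e^1_j)_j,\dots,(e^{2m}_j)_j$ of $H$ with a common index set, where $\rho e^1_j=\omega_j e^1_j$ and $e^2,\dots,e^{2m}$ are arbitrary, put for a multi-index $j=(j_1,\dots,j_{2m})$, writing $e^k$ for $e^k_{j_k}$, $$b_j=e^{2m}\otimes e^{2m-1}\otimes\cdots\otimes e^{m+1}\otimes e^1\otimes\cdots\otimes e^m,\qquad c_j=e^1\otimes e^{2m}\otimes\cdots\otimes e^{m+2}\otimes e^2\otimes\cdots\otimes e^{m+1},$$ as vectors of $\mathcal H\otimes\mathcal H$. Let $F(\mathcal H)$ be the space of finite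 rank operators on $\mathcal H$. Then there are a functional $d$ on pairs of finite rank projections of $\mathcal H$, a bounded sesquilinear form $S_\rho$ and a bounded operator $X_\rho$ on $\mathcal H\otimes\mathcal H$, none of which depends on the choice of bases, such that: (i) $d(p,q)=d_\rho(p,q)$ whenever $p,q$ are homogeneous histories of finite rank, and for every choice of bases, all finite rank projections $p,q$ on $\mathcal H$ and all $\xi,\eta\in\mathcal H\otimes\mathcal H$, the following ILS series converge unconditionally: $$d(p,q)=\sum_j\omega_{j_1}\langle b_j,(p\otimes q)c_j\rangle,\qquad S_\rho(\xi,\eta)=\sum_j\omega_{j_1}\langle b_j,\xi\rangle\langle\eta,c_j\rangle,\qquad X_\rho\xi=\sum_j\omega_{j_1}\langle b_j,\xi\rangle c_j .$$ (ii) $|S_\rho(\xi,\eta)|\le\|\xi\|\,\|\eta\|$ and $S_\rho(\xi,\eta)=\langle\eta,X_\rho\xi\rangle$ for all $\xi,\eta$. (iii) $d_\rho$ is tracially bounded, in the following sense. The functional $d$ satisfies the axioms of a decoherence functional on finite rank projections: $d(p,p)\ge0$; $d(p,q)=\overline{d(q,p)}$; $d(0,q)=0$; $d(p+p',q)=d(p,q)+d(p',q)$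 if $pp'=0$; and $d(1,1)=1$ if $\dim\mathcal H<\infty$. If $\dim\mathcal H<\infty$, then $d$ is bounded. There is a linear functional $\beta$ on $F(\mathcal H)\otimes_{\mathrm{alg}}F(\mathcal H)$ with $\beta(p\otimes q)=d(p,q)$ for all finite rank projections $p,q$, and $|\beta(|\xi\rangle\langle\xi|)|$ is bounded over the unit vectors $\xi\in\mathcal H\otimes_{\mathrm{alg}}\mathcal H$. Moreover, $\beta(|\xi\rangle\langle\eta|)=S_\rho(\xi,\eta)$ for all $\xi,\eta\in\mathcal H\otimes_{\mathrm{alg}}\mathcal H$, so that the bound may be taken to be $1$. (iv) $d_\rho$ has the pseudo-ILS representation $$d(p,q)=\mathrm{tr}_{\mathcal H\otimes\mathcal H}\bigl(X_\rho(p\otimes q)\bigr)$$ for all finite rank projections $p,q$ on $\mathcal H$, where $X_\rho(p\otimes q)$ is trace class. $X_\rho$ is the only bounded operator $M$ with $d_\rho(h,k)=\mathrm{tr}(M(h\otimes k))$ for all homogeneous histories $h,k$ whose factors have finite rank. If $H$ is infinite dimensional, then $X_\rho$ is not trace class. -/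

import Mathlib

open scoped TensorProduct InnerProductSpace ComplexConjugate

noncomputable section

namespace HistoryQM

/-! ## Hilbert space tensor products -/

/-- The Hilbert space tensor product: the completion of the algebraic tensor product for the
inner product with `⟪x ⊗ y, x' ⊗ y'⟫ = ⟪x, x'⟫ * ⟪y, y'⟫`. -/
abbrev HTensor (E F : Type*) [NormedAddCommGroup E] [InnerProductSpace ℂ E]
    [NormedAddCommGroup F] [InnerProductSpace ℂ F] : Type _ :=
  UniformSpace.Completion (E ⊗[ℂ] F)

/-- The product vector `x ⊗ y` of the Hilbert space tensor product. -/
def htmul {E F : Type*} [NormedAddCommGroup E] [InnerProductSpace ℂ E]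
    [NormedAddCommGroup F] [InnerProductSpace ℂ F] (x : E) (y : F) : HTensor E F :=
  ((x ⊗ₜ[ℂ] y : E ⊗[ℂ] F) : HTensor E F)

/-- The bounded operator `a ⊗ b` on the Hilbert space tensor product. -/
def opTensor {E F : Type*} [NormedAddCommGroup E] [InnerProductSpace ℂ E]
    [NormedAddCommGroup F] [InnerProductSpace ℂ F] (a : E →L[ℂ] E) (b : F →L[ℂ] F) :
    HTensor E F →L[ℂ] HTensor E F :=
  (TensorProduct.mapL a b).completion

/-- A bundled complex Hilbert space, used only to define tensor powers by recursion. -/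
structure HilbertObj where
  carrier : Type*
  [group : NormedAddCommGroup carrier]
  [inner : InnerProductSpace ℂ carrier]
  [complete : CompleteSpace carrier]

attribute [instance] HilbertObj.group HilbertObj.inner HilbertObj.complete

section Histories

universe u
variable (H : Type u) [NormedAddCommGroup H] [InnerProductSpace ℂ H] [CompleteSpace H]

/-- The Hilbert space tensor power of `H` with `n + 1` factors, bracketed to the left. -/
def tensorPowerObj : ℕ → HilbertObj.{u}
  | 0 => ⟨H⟩
  | n + 1 => ⟨HTensor (tensorPowerObj n).carrier H⟩

/-- The history Hilbert space of `(n + 1)`-time histories: the `(n + 1)`-fold Hilbert space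
tensor product of the single time Hilbert space `H`. -/
abbrev HistSpace (n : ℕ) : Type u := (tensorPowerObj H n).carrier

variable {H}

/-- The product vector `x₀ ⊗ x₁ ⊗ ⋯ ⊗ xₙ`. -/
def pureTensor : (n : ℕ) → (Fin (n + 1) → H) → HistSpace H n
  | 0, x => x 0
  | n + 1, x => htmul (pureTensor n (Fin.init x)) (x (Fin.last (n + 1)))

/-- The product operator `a₀ ⊗ a₁ ⊗ ⋯ ⊗ aₙ`. For projections `aᵢ` this is the homogeneous
history `a₀, a₁, …, aₙ` as a projection operator on the history Hilbert space. -/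
def pureOp : (n : ℕ) → (Fin (n + 1) → (H →L[ℂ] H)) → (HistSpace H n →L[ℂ] HistSpace H n)
  | 0, a => a 0
  | n + 1, a => opTensor (pureOp n (Fin.init a)) (a (Fin.last (n + 1)))

end Histories

/-! ## Trace class operators and density operators -/

section Trace

variable {E : Type*} [NormedAddCommGroup E] [InnerProductSpace ℂ E] [CompleteSpace E]

variable (E) in
/-- The index set of a chosen orthonormal basis of `E`. -/
def basisIndex : Set E := (exists_hilbertBasis ℂ E).choose

variable (E) in
/-- A chosen orthonormal basis of `E`. -/
def chosenBasis : HilbertBasis (basisIndex E) ℂ E := (exists_hilbertBasis ℂ E).choose_spec.choose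

/-- `T` is trace class: the diagonal of `|T| = (T* T)^(1/2)` in an orthonormal basis is summable.
This does not depend on the basis. -/
def IsTraceClass (T : E →L[ℂ] E) : Prop :=
  Summable fun i => RCLike.re ⟪chosenBasis E i, CFC.abs T (chosenBasis E i)⟫_ℂ

/-- The trace of a trace class operator. It does not depend on the basis. -/
def opTrace (T : E →L[ℂ] E) : ℂ :=
  ∑' i, ⟪chosenBasis E i, T (chosenBasis E i)⟫_ℂ

/-- Density operators: positive trace class operators with trace one. -/
structure IsDensityOperator (ρ : E →L[ℂ] E) : Prop where
  isPositive : ρ.IsPositive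
  isTraceClass : IsTraceClass ρ
  trace_eq_one : opTrace ρ = 1

/-- The standard decoherence functional on homogeneous histories,
`d_ρ(h, k) = tr (hₙ ⋯ h₁ h₀ ρ k₀ k₁ ⋯ kₙ)`. -/
def standardDF (ρ : E →L[ℂ] E) {n : ℕ} (h k : Fin (n + 1) → (E →L[ℂ] E)) : ℂ :=
  opTrace ((List.ofFn h).reverse.prod * ρ * (List.ofFn k).prod)

end Trace

/-! ## Finite rank histories, and functionals on them -/

section Functionals

variable {E : Type*} [NormedAddCommGroup E] [InnerProductSpace ℂ E]

/-- Operators of finite rank. -/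
def IsFiniteRank (T : E →L[ℂ] E) : Prop :=
  FiniteDimensional ℂ (LinearMap.range (T : E →ₗ[ℂ] E))

variable (E) in
/-- The algebraic tensor product `F(E) ⊗_alg F(E)` of the finite rank operators by themselves,
realized as a space of operators on the Hilbert space tensor product of `E` by itself. -/
def finRankTensor : Submodule ℂ (HTensor E E →L[ℂ] HTensor E E) :=
  Submodule.span ℂ {T | ∃ a b : E →L[ℂ] E, IsFiniteRank a ∧ IsFiniteRank b ∧ T = opTensor a b}

lemma opTensor_mem {a b : E →L[ℂ] E} (ha : IsFiniteRank a) (hb : IsFiniteRank b) :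
    opTensor a b ∈ finRankTensor E :=
  Submodule.subset_span ⟨a, b, ha, hb, rfl⟩

lemma isFiniteRank_rankOne (x y : E) : IsFiniteRank (InnerProductSpace.rankOne ℂ x y) := by
  refine Submodule.finiteDimensional_of_le (S₂ := Submodule.span ℂ {x}) ?_
  rintro _ ⟨z, rfl⟩
  exact Submodule.smul_mem _ _ (Submodule.mem_span_singleton_self x)

lemma rankOne_htmul (a b c d : E) :
    InnerProductSpace.rankOne ℂ (htmul a b) (htmul c d) =
      opTensor (InnerProductSpace.rankOne ℂ a c) (InnerProductSpace.rankOne ℂ b d) := by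
  ext z
  induction z using UniformSpace.Completion.induction_on with
  | hp => exact isClosed_eq (ContinuousLinearMap.continuous _) (ContinuousLinearMap.continuous _)
  | ih z =>
    induction z using TensorProduct.induction_on with
    | zero => rw [UniformSpace.Completion.coe_zero, map_zero, map_zero]
    | add x y hx hy => simp only [UniformSpace.Completion.coe_add, map_add, hx, hy]
    | tmul x y =>
      simp only [opTensor, htmul, InnerProductSpace.rankOne_apply,
        ContinuousLinearMap.completion_apply_coe, TensorProduct.mapL_tmul,
        UniformSpace.Completion.inner_coe, TensorProduct.inner_tmul,
        ← UniformSpace.Completion.coe_smul, TensorProduct.smul_tmul_smul]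

/-- `|ξ⟩⟨η|` belongs to `F(E) ⊗_alg F(E)` for `ξ` and `η` in the algebraic tensor product. -/
lemma rankOne_mem (ξ η : E ⊗[ℂ] E) :
    InnerProductSpace.rankOne ℂ (ξ : HTensor E E) (η : HTensor E E) ∈ finRankTensor E := by
  induction ξ using TensorProduct.induction_on with
  | zero =>
    rw [UniformSpace.Completion.coe_zero, map_zero, zero_apply]
    exact Submodule.zero_mem _
  | add x y hx hy =>
    simp only [UniformSpace.Completion.coe_add, map_add, add_apply]
    exact Submodule.add_mem _ hx hy
  | tmul a b =>
    induction η using TensorProduct.induction_on with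
    | zero =>
      rw [UniformSpace.Completion.coe_zero, map_zero]
      exact Submodule.zero_mem _
    | add x y hx hy =>
      simp only [UniformSpace.Completion.coe_add, map_add]
      exact Submodule.add_mem _ hx hy
    | tmul c d =>
      have h := rankOne_htmul a b c d
      simp only [htmul] at h
      rw [h]
      exact opTensor_mem (isFiniteRank_rankOne _ _) (isFiniteRank_rankOne _ _)

/-- The operator `|ξ⟩⟨η|` as an element of `F(E) ⊗_alg F(E)`. -/
def ketBra (ξ η : E ⊗[ℂ] E) : finRankTensor E :=
  ⟨InnerProductSpace.rankOne ℂ (ξ : HTensor E E) (η : HTensor E E), rankOne_mem ξ η⟩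

variable [CompleteSpace E]

variable (E) in
/-- Projection operators of finite rank on `E`. -/
abbrev FinRankProj : Type _ := {p : E →L[ℂ] E // IsStarProjection p ∧ IsFiniteRank p}

/-- The operator `p ⊗ q` as an element of `F(E) ⊗_alg F(E)`. -/
def projTensor (p q : FinRankProj E) : finRankTensor E :=
  ⟨opTensor p.1 q.1, opTensor_mem p.2.2 q.2.2⟩

/-- The axioms of a decoherence functional, for a functional on the finite rank projections
(these are all projections if `E` is finite dimensional). -/
structure IsDecoherenceFunctional (d : FinRankProj E → FinRankProj E → ℂ) : Prop where
  nonneg : ∀ p, (d p p).im = 0 ∧ 0 ≤ (d p p).re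
  conj_symm : ∀ p q, d p q = conj (d q p)
  one : ∀ p, p.1 = 1 → d p p = 1
  zero : ∀ p q, p.1 = 0 → d p q = 0
  add : ∀ p p' r q, p.1 * p'.1 = 0 → r.1 = p.1 + p'.1 → d r q = d p q + d p' q

/-- `β` is the linear functional on `F(E) ⊗_alg F(E)` that corresponds to `d`. As the finite rank
projections span the finite rank operators, there is at most one. -/
def IsAssociated (d : FinRankProj E → FinRankProj E → ℂ) (β : finRankTensor E →ₗ[ℂ] ℂ) : Prop :=
  ∀ p q, β (projTensor p q) = d p q

/-- Tracial boundedness of a decoherence functional `d` given on the finite rank projections.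
If `E` is finite dimensional then `d` is defined on all projections, and is required to be
bounded. -/
structure IsTraciallyBounded (d : FinRankProj E → FinRankProj E → ℂ) : Prop where
  decoherence : IsDecoherenceFunctional d
  bounded : FiniteDimensional ℂ E → ∃ K : ℝ, ∀ p q, ‖d p q‖ ≤ K
  tracial : ∃ β : finRankTensor E →ₗ[ℂ] ℂ, IsAssociated d β ∧
    ∃ C : ℝ, ∀ ξ : E ⊗[ℂ] E, ‖ξ‖ = 1 → ‖β (ketBra ξ ξ)‖ ≤ C

end Functionals

/-! ## The ILS series -/

section ILS

/-- `(H ⊗ ⋯ ⊗ H) ⊗ (H ⊗ ⋯ ⊗ H)` with `2 (n + 1)` factors. -/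
abbrev DoubleHistSpace (H : Type*) [NormedAddCommGroup H] [InnerProductSpace ℂ H]
    [CompleteSpace H] (n : ℕ) : Type _ := HTensor (HistSpace H n) (HistSpace H n)

variable {H : Type*} [NormedAddCommGroup H] [InnerProductSpace ℂ H] [CompleteSpace H]

/-- For vectors `e¹, …, e²ᵐ` with `m = n + 1`, written `v 0, …, v (2 m - 1)`, the vector
`(e²ᵐ ⊗ e²ᵐ⁻¹ ⊗ ⋯ ⊗ eᵐ⁺¹) ⊗ (e¹ ⊗ e² ⊗ ⋯ ⊗ eᵐ)`. -/
def ilsBra {n : ℕ} (v : Fin (2 * (n + 1)) → H) : DoubleHistSpace H n :=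
  htmul (pureTensor n fun k => v ⟨2 * n + 1 - k, by omega⟩)
    (pureTensor n fun k => v ⟨k, by omega⟩)

/-- For vectors `e¹, …, e²ᵐ` with `m = n + 1`, written `v 0, …, v (2 m - 1)`, the vector
`(e¹ ⊗ e²ᵐ ⊗ e²ᵐ⁻¹ ⊗ ⋯ ⊗ eᵐ⁺²) ⊗ (e² ⊗ e³ ⊗ ⋯ ⊗ eᵐ⁺¹)`. -/
def ilsKet {n : ℕ} (v : Fin (2 * (n + 1)) → H) : DoubleHistSpace H n :=
  htmul (pureTensor n fun k => if k = 0 then v 0 else v (Fin.ofNat _ (2 * n + 2 - k)))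
    (pureTensor n fun k => v ⟨k + 1, by omega⟩)

/-- The orthonormal bases `e¹, …, e²ᵐ` (`m = n + 1`) and numbers `ω` of an ILS series for `ρ`:
`e¹` diagonalizes `ρ` with eigenvalues `ω`, and the other bases are arbitrary. -/
structure ILSData (ρ : H →L[ℂ] H) (n : ℕ) (ι : Type*) where
  e : Fin (2 * (n + 1)) → HilbertBasis ι ℂ H
  ω : ι → ℝ
  spectral : ∀ i, ρ (e 0 i) = (ω i : ℂ) • e 0 i

variable {ρ : H →L[ℂ] H} {n : ℕ} {ι : Type*}

/-- The bra vector of the ILS series at the multi-index `j`. -/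
def ILSData.bra (D : ILSData ρ n ι) (j : Fin (2 * (n + 1)) → ι) : DoubleHistSpace H n :=
  ilsBra fun k => D.e k (j k)

/-- The ket vector of the ILS series at the multi-index `j`. -/
def ILSData.ket (D : ILSData ρ n ι) (j : Fin (2 * (n + 1)) → ι) : DoubleHistSpace H n :=
  ilsKet fun k => D.e k (j k)

/-- The coefficient of the ILS series at the multi-index `j`. -/
def ILSData.coeff (D : ILSData ρ n ι) (j : Fin (2 * (n + 1)) → ι) : ℂ := (D.ω (j 0) : ℂ)

end ILS

end HistoryQM

end

open HistoryQM

noncomputable section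

namespace HistoryQM

/-! ### Product vectors and product operators on a Hilbert space tensor product. -/

section TensorProduct

variable {E F : Type*} [NormedAddCommGroup E] [InnerProductSpace ℂ E]
  [NormedAddCommGroup F] [InnerProductSpace ℂ F]

/-! The operator `X_ρ` is explicit: let `ρ` act on the tensor factor that carries `e¹`, then permute
the `2m` factors by the unitary that takes the order of factors in `b_j` to that in `c_j` (`ilsOp`).
Then `X_ρ b_j = ω c_j` (`ILSData.ilsOp_bra`). Since the `b_j` form an orthonormal basis
(`doubleBasis`), the ILS series are expansions of `X_ρ ξ`, of `⟪η, X_ρ ξ⟫` and of a trace in that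
basis, so their sums do not depend on it. The bounds on `S_ρ` and `β` follow from `‖X_ρ‖ ≤ ‖ρ‖ ≤ 1`.

The permutation reproduces the contractions in `tr (h_m ⋯ h_1 ρ k_1 ⋯ k_m)`: for rank one factors
both traces are the same product of inner products, and multilinearity extends this to finite rank
(`exists_hasSum_homogeneous`).

Positivity and hermitian symmetry of `d` come from `ρ = S²`: placing one `S` on each side of `p ⊗ q`
turns `d(p,q)` into a sum of terms `conj (g_p) * g_q` (`hasSum_gram`).

For uniqueness, rank one projections give the expectation values of `M` in product vectors, and
polarization in one factor at a time recovers `M` (`eq_zero_of_inner_doublePure_self`). In infinite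
dimension `X_ρ` is not even Hilbert–Schmidt, because the factor `eᵐ⁺¹` is moved but not acted upon
(`not_isTraceClass_ilsOp`). -/

lemma inner_htmul (x x' : E) (y y' : F) :
    ⟪htmul x y, htmul x' y'⟫_ℂ = ⟪x, x'⟫_ℂ * ⟪y, y'⟫_ℂ := by
  simp only [htmul, UniformSpace.Completion.inner_coe, TensorProduct.inner_tmul]

lemma norm_htmul (x : E) (y : F) : ‖htmul x y‖ = ‖x‖ * ‖y‖ := by
  simp only [htmul, UniformSpace.Completion.norm_coe, TensorProduct.norm_tmul]

lemma htmul_add_left (x x' : E) (y : F) : htmul (x + x') y = htmul x y + htmul x' y := by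
  simp only [htmul, TensorProduct.add_tmul, UniformSpace.Completion.coe_add]

lemma htmul_add_right (x : E) (y y' : F) : htmul x (y + y') = htmul x y + htmul x y' := by
  simp only [htmul, TensorProduct.tmul_add, UniformSpace.Completion.coe_add]

lemma htmul_smul_left (c : ℂ) (x : E) (y : F) : htmul (c • x) y = c • htmul x y := by
  rw [htmul, ← TensorProduct.smul_tmul', UniformSpace.Completion.coe_smul, htmul]

lemma htmul_smul_right (c : ℂ) (x : E) (y : F) : htmul x (c • y) = c • htmul x y := by
  simp only [htmul, TensorProduct.tmul_smul, UniformSpace.Completion.coe_smul]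

/-- The bilinear map `x, y ↦ x ⊗ y` into the Hilbert space tensor product. -/
def htmulL : E →L[ℂ] F →L[ℂ] HTensor E F :=
  (LinearMap.mk₂ ℂ htmul htmul_add_left htmul_smul_left htmul_add_right
    htmul_smul_right).mkContinuous₂ 1 fun x y => by simp [norm_htmul]

@[simp] lemma htmulL_apply (x : E) (y : F) : htmulL x y = htmul x y := rfl

lemma opTensor_htmul (a : E →L[ℂ] E) (b : F →L[ℂ] F) (x : E) (y : F) :
    opTensor a b (htmul x y) = htmul (a x) (b y) := by
  simp only [opTensor, htmul, ContinuousLinearMap.completion_apply_coe, TensorProduct.mapL_tmul]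

lemma htensor_clm_ext {G : Type*} [NormedAddCommGroup G] [NormedSpace ℂ G]
    {f g : HTensor E F →L[ℂ] G} (h : ∀ x y, f (htmul x y) = g (htmul x y)) : f = g := by
  ext z
  induction z using UniformSpace.Completion.induction_on with
  | hp => exact isClosed_eq f.continuous g.continuous
  | ih z =>
    induction z using TensorProduct.induction_on with
    | zero => rw [UniformSpace.Completion.coe_zero, map_zero, map_zero]
    | add x y hx hy => rw [UniformSpace.Completion.coe_add, map_add, map_add, hx, hy]
    | tmul x y => exact h x y

lemma norm_opTensor_le (a : E →L[ℂ] E) (b : F →L[ℂ] F) : ‖opTensor a b‖ ≤ ‖a‖ * ‖b‖ := by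
  refine ContinuousLinearMap.opNorm_le_bound _ (by positivity) fun z => ?_
  induction z using UniformSpace.Completion.induction_on with
  | hp => exact isClosed_le (opTensor a b).continuous.norm (continuous_const.mul continuous_norm)
  | ih z =>
    rw [opTensor, ContinuousLinearMap.completion_apply_coe, UniformSpace.Completion.norm_coe,
      UniformSpace.Completion.norm_coe]
    exact (TensorProduct.mapL a b).le_of_opNorm_le (TensorProduct.norm_mapL_le a b) z

lemma opTensor_add_left (a a' : E →L[ℂ] E) (b : F →L[ℂ] F) :
    opTensor (a + a') b = opTensor a b + opTensor a' b :=
  htensor_clm_ext fun x y => by simp [opTensor_htmul, htmul_add_left]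

lemma opTensor_add_right (a : E →L[ℂ] E) (b b' : F →L[ℂ] F) :
    opTensor a (b + b') = opTensor a b + opTensor a b' :=
  htensor_clm_ext fun x y => by simp [opTensor_htmul, htmul_add_right]

lemma opTensor_smul_left (c : ℂ) (a : E →L[ℂ] E) (b : F →L[ℂ] F) :
    opTensor (c • a) b = c • opTensor a b :=
  htensor_clm_ext fun x y => by simp [opTensor_htmul, htmul_smul_left]

lemma opTensor_smul_right (c : ℂ) (a : E →L[ℂ] E) (b : F →L[ℂ] F) :
    opTensor a (c • b) = c • opTensor a b :=
  htensor_clm_ext fun x y => by simp [opTensor_htmul, htmul_smul_right]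

lemma opTensor_zero_left (b : F →L[ℂ] F) : opTensor (0 : E →L[ℂ] E) b = 0 := by
  simpa using opTensor_smul_left (0 : ℂ) (0 : E →L[ℂ] E) b

lemma opTensor_zero_right (a : E →L[ℂ] E) : opTensor a (0 : F →L[ℂ] F) = 0 := by
  simpa using opTensor_smul_right (0 : ℂ) a (0 : F →L[ℂ] F)

lemma opTensor_comp (a a' : E →L[ℂ] E) (b b' : F →L[ℂ] F) :
    opTensor a b ∘L opTensor a' b' = opTensor (a ∘L a') (b ∘L b') :=
  htensor_clm_ext fun x y => by simp [opTensor_htmul]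

end TensorProduct

/-! ### Finite rank operators as sums of rank one operators. -/

section FiniteRank

variable {E : Type*} [NormedAddCommGroup E] [InnerProductSpace ℂ E]

lemma IsFiniteRank.exists_eq_sum [CompleteSpace E] {a : E →L[ℂ] E} (ha : IsFiniteRank a) :
    ∃ (r : ℕ) (u v : Fin r → E), a = ∑ i, InnerProductSpace.rankOne ℂ (u i) (v i) := by
  have : FiniteDimensional ℂ (LinearMap.range (a : E →ₗ[ℂ] E)) := ha
  let b := stdOrthonormalBasis ℂ (LinearMap.range (a : E →ₗ[ℂ] E))
  -- With `b` an orthonormal basis of the range, `a x = ∑ ⟪b i, a x⟫ b i`, and `a` moves to the left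
  -- as its adjoint.
  refine ⟨_, fun i => b i, fun i => a.adjoint (b i), ?_⟩
  ext x
  have h := congrArg Subtype.val (b.sum_repr' ⟨a x, x, rfl⟩)
  simp only [AddSubmonoidClass.coe_finsetSum, Submodule.coe_smul, Submodule.coe_inner] at h
  rw [sum_apply]
  simp only [InnerProductSpace.rankOne_apply, ContinuousLinearMap.adjoint_inner_left]
  exact h.symm

/-- Induction principle for `F(E) ⊗_alg F(E)`: it is spanned by the `|x ⊗ y⟩⟨x' ⊗ y'|`. -/
lemma finRankTensor_induction [CompleteSpace E] {P : (HTensor E E →L[ℂ] HTensor E E) → Prop}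
    (zero : P 0) (add : ∀ S T, P S → P T → P (S + T)) (smul : ∀ (c : ℂ) T, P T → P (c • T))
    (rankOne : ∀ ξ η : HTensor E E, P (InnerProductSpace.rankOne ℂ ξ η))
    {T : HTensor E E →L[ℂ] HTensor E E} (hT : T ∈ finRankTensor E) : P T := by
  have sum : ∀ {r : ℕ} (f : Fin r → (HTensor E E →L[ℂ] HTensor E E)), (∀ i, P (f i)) →
      P (∑ i, f i) := fun f hf => Finset.sum_induction f P add zero fun i _ => hf i
  induction hT using Submodule.span_induction with
  | zero => exact zero
  | add S T _ _ hS hT => exact add S T hS hT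
  | smul c T _ hT => exact smul c T hT
  | mem T hT =>
    obtain ⟨a, b, ha, hb, rfl⟩ := hT
    obtain ⟨r, u, v, rfl⟩ := ha.exists_eq_sum
    obtain ⟨s, u', v', rfl⟩ := hb.exists_eq_sum
    have h₁ : ∀ b : E →L[ℂ] E, opTensor (∑ i, InnerProductSpace.rankOne ℂ (u i) (v i)) b =
        ∑ i, opTensor (InnerProductSpace.rankOne ℂ (u i) (v i)) b := fun b =>
      map_sum (AddMonoidHom.mk' (fun a : E →L[ℂ] E => opTensor a b)
        fun a a' => opTensor_add_left a a' b) _ _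
    have h₂ : ∀ a : E →L[ℂ] E, opTensor a (∑ i, InnerProductSpace.rankOne ℂ (u' i) (v' i)) =
        ∑ i, opTensor a (InnerProductSpace.rankOne ℂ (u' i) (v' i)) := fun a =>
      map_sum (AddMonoidHom.mk' (fun b : E →L[ℂ] E => opTensor a b)
        fun b b' => opTensor_add_right a b b') _ _
    rw [h₁]
    refine sum _ fun i => ?_
    rw [h₂]
    refine sum _ fun k => ?_
    rw [← rankOne_htmul]
    exact rankOne _ _

end FiniteRank

/-! ### Product vectors with `n + 1` factors; multilinearity and extension principles. -/

section PureTensor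

variable {H : Type*} [NormedAddCommGroup H] [InnerProductSpace ℂ H] [CompleteSpace H]

lemma pureTensor_succ (n : ℕ) (x : Fin (n + 2) → H) :
    pureTensor (n + 1) x =
      (htmul (pureTensor n (Fin.init x)) (x (Fin.last (n + 1))) : HTensor (HistSpace H n) H) := rfl

lemma pureTensor_update_add : ∀ (n : ℕ) (x : Fin (n + 1) → H) (i : Fin (n + 1)) (u v : H),
    pureTensor n (Function.update x i (u + v)) =
      pureTensor n (Function.update x i u) + pureTensor n (Function.update x i v)
  | 0, x, i, u, v => by
    obtain rfl : i = 0 := Subsingleton.elim (α := Fin 1) _ _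
    change Function.update x 0 (u + v) 0 = Function.update x 0 u 0 + Function.update x 0 v 0
    simp only [Function.update_self]
  | n + 1, x, i, u, v => by
    simp only [pureTensor_succ]
    induction i using Fin.lastCases with
    | last => simp only [Fin.init_update_last, Function.update_self]; exact htmul_add_right _ _ _
    | cast i =>
      simp only [Fin.init_update_castSucc, pureTensor_update_add n,
        Function.update_of_ne (Fin.castSucc_lt_last i).ne']
      exact htmul_add_left _ _ _

lemma pureTensor_update_smul : ∀ (n : ℕ) (x : Fin (n + 1) → H) (i : Fin (n + 1)) (c : ℂ) (u : H),
    pureTensor n (Function.update x i (c • u)) = c • pureTensor n (Function.update x i u)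
  | 0, x, i, c, u => by
    obtain rfl : i = 0 := Subsingleton.elim (α := Fin 1) _ _
    change Function.update x 0 (c • u) 0 = c • Function.update x 0 u 0
    simp only [Function.update_self]
  | n + 1, x, i, c, u => by
    simp only [pureTensor_succ]
    induction i using Fin.lastCases with
    | last => simp only [Fin.init_update_last, Function.update_self]; exact htmul_smul_right _ _ _
    | cast i =>
      simp only [Fin.init_update_castSucc, pureTensor_update_smul n,
        Function.update_of_ne (Fin.castSucc_lt_last i).ne']
      exact htmul_smul_left _ _ _

lemma inner_pureTensor : ∀ (n : ℕ) (x y : Fin (n + 1) → H),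
    ⟪pureTensor n x, pureTensor n y⟫_ℂ = ∏ i, ⟪x i, y i⟫_ℂ
  | 0, x, y => by rw [Fin.prod_univ_one]; rfl
  | n + 1, x, y => by
    rw [Fin.prod_univ_castSucc]
    exact (inner_htmul _ _ _ _).trans (by rw [inner_pureTensor n]; rfl)

lemma norm_pureTensor : ∀ (n : ℕ) (x : Fin (n + 1) → H), ‖pureTensor n x‖ = ∏ i, ‖x i‖
  | 0, x => by rw [Fin.prod_univ_one]; rfl
  | n + 1, x => by
    rw [Fin.prod_univ_castSucc]
    exact (norm_htmul _ _).trans (by rw [norm_pureTensor n]; rfl)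

lemma histSpace_clm_ext {G : Type*} [NormedAddCommGroup G] [NormedSpace ℂ G] : ∀ (n : ℕ)
    {f g : HistSpace H n →L[ℂ] G}, (∀ x, f (pureTensor n x) = g (pureTensor n x)) → f = g
  | 0, f, g, h => ContinuousLinearMap.ext fun x => h fun _ => x
  | n + 1, f, g, h => by
    refine htensor_clm_ext (E := HistSpace H n) (F := H) (f := f) (g := g) fun u y => ?_
    have : ContinuousLinearMap.comp (f : HTensor (HistSpace H n) H →L[ℂ] G) (htmulL.flip y) =
        ContinuousLinearMap.comp (g : HTensor (HistSpace H n) H →L[ℂ] G) (htmulL.flip y) := by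
      refine histSpace_clm_ext n fun x => ?_
      have := h (Fin.snoc (α := fun _ => H) x y)
      rw [pureTensor_succ, Fin.init_snoc, Fin.snoc_last] at this
      exact this
    exact congrArg (fun f => f u) this

lemma pureOp_pureTensor : ∀ (n : ℕ) (a : Fin (n + 1) → (H →L[ℂ] H)) (x : Fin (n + 1) → H),
    pureOp n a (pureTensor n x) = pureTensor n fun i => a i (x i)
  | 0, a, x => rfl
  | n + 1, a, x => (opTensor_htmul _ _ _ _).trans (by rw [pureOp_pureTensor n]; rfl)

lemma norm_pureOp_le : ∀ (n : ℕ) (a : Fin (n + 1) → (H →L[ℂ] H)), ‖pureOp n a‖ ≤ ∏ i, ‖a i‖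
  | 0, a => by rw [Fin.prod_univ_one]; rfl
  | n + 1, a => by
    rw [Fin.prod_univ_castSucc]
    exact (norm_opTensor_le _ _).trans
      (mul_le_mul_of_nonneg_right (norm_pureOp_le n _) (norm_nonneg _))

variable (H) in
/-- The continuous multilinear map `x ↦ x₀ ⊗ ⋯ ⊗ xₙ`. -/
def pureTensorL (n : ℕ) : ContinuousMultilinearMap ℂ (fun _ : Fin (n + 1) => H) (HistSpace H n) :=
  MultilinearMap.mkContinuous
    { toFun := pureTensor n
      map_update_add' := fun {inst} x i u v => by
        -- The fields of `MultilinearMap` quantify over all `DecidableEq` instances, hence the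
        -- change of instance.
        rw [Subsingleton.elim inst (instDecidableEqFin _)]; exact pureTensor_update_add n x i u v
      map_update_smul' := fun {inst} x i c u => by
        rw [Subsingleton.elim inst (instDecidableEqFin _)]; exact pureTensor_update_smul n x i c u }
    1 fun x => by rw [one_mul]; exact (norm_pureTensor n x).le

@[simp] lemma pureTensorL_apply (n : ℕ) (x : Fin (n + 1) → H) :
    pureTensorL H n x = pureTensor n x := rfl

/-- A continuous multilinear map is determined by its values on orthonormal bases. -/
lemma cmm_ext_hilbertBasis {H σ ι G : Type*} [NormedAddCommGroup H] [InnerProductSpace ℂ H]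
    [Fintype σ] [NormedAddCommGroup G] [NormedSpace ℂ G] (e : σ → HilbertBasis ι ℂ H) {f g : ContinuousMultilinearMap ℂ (fun _ : σ => H) G}
    (h : ∀ j : σ → ι, f (fun s => e s (j s)) = g (fun s => e s (j s))) : f = g := by
  classical
  -- `t` is the set of slots whose entry need not be a basis vector. Enlarging `t` by one slot uses
  -- linearity, continuity and density of the span in that slot.
  have key : ∀ (t : Finset σ) (w : σ → H), (∀ s ∉ t, ∃ i, e s i = w s) → f w = g w := by
    intro t
    induction t using Finset.induction_on with
    | empty =>
      intro w hw
      choose j hj using fun s => hw s (Finset.notMem_empty s)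
      simpa only [hj] using h j
    | insert s t _ ih =>
      intro w hw
      have : f.toContinuousLinearMap w s = g.toContinuousLinearMap w s := by
        refine ContinuousLinearMap.ext_on
          (Submodule.dense_iff_topologicalClosure_eq_top.mpr (e s).dense_span) ?_
        rintro _ ⟨i, rfl⟩
        refine ih _ fun s' hs' => ?_
        by_cases hss : s' = s
        · subst hss; exact ⟨i, by simp⟩
        · rw [Function.update_of_ne hss]
          exact hw s' (by simp [hss, hs'])
      simpa using congrArg (fun f => f (w s)) this
  ext w
  exact key Finset.univ w fun s hs => absurd (Finset.mem_univ s) hs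

end PureTensor

/-! ### Product vectors with `2 (n + 1)` factors and their orthonormal bases. -/

section DoublePure

variable {H : Type*} [NormedAddCommGroup H] [InnerProductSpace ℂ H] [CompleteSpace H] {n : ℕ}

/-- The product vector of `(H ⊗ ⋯ ⊗ H) ⊗ (H ⊗ ⋯ ⊗ H)` with the given factors. -/
def doublePure (w : Fin (n + 1) ⊕ Fin (n + 1) → H) : DoubleHistSpace H n :=
  htmul (pureTensor n fun i => w (.inl i)) (pureTensor n fun i => w (.inr i))

lemma doublePure_elim (x y : Fin (n + 1) → H) :
    doublePure (Sum.elim x y) = htmul (pureTensor n x) (pureTensor n y) := rfl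

lemma inner_doublePure (w w' : Fin (n + 1) ⊕ Fin (n + 1) → H) :
    ⟪doublePure w, doublePure w'⟫_ℂ = ∏ s, ⟪w s, w' s⟫_ℂ := by
  rw [doublePure, doublePure, inner_htmul, inner_pureTensor, inner_pureTensor, Fintype.prod_sum_type]

lemma norm_doublePure (w : Fin (n + 1) ⊕ Fin (n + 1) → H) : ‖doublePure w‖ = ∏ s, ‖w s‖ := by
  rw [doublePure, norm_htmul, norm_pureTensor, norm_pureTensor, Fintype.prod_sum_type]

lemma doublePure_update_inl (w : Fin (n + 1) ⊕ Fin (n + 1) → H) (i : Fin (n + 1)) (u : H) :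
    doublePure (Function.update w (.inl i) u) =
      htmul (pureTensor n (Function.update (fun i => w (.inl i)) i u))
        (pureTensor n fun i => w (.inr i)) := by
  rw [doublePure]
  congr 2
  exact Sum.update_inl_comp_inl

lemma doublePure_update_inr (w : Fin (n + 1) ⊕ Fin (n + 1) → H) (i : Fin (n + 1)) (u : H) :
    doublePure (Function.update w (.inr i) u) = htmul (pureTensor n fun i => w (.inl i))
      (pureTensor n (Function.update (fun i => w (.inr i)) i u)) := by
  rw [doublePure]
  congr 2
  exact Sum.update_inr_comp_inr

variable (H n) in
/-- `doublePure` as a continuous multilinear map. -/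
def doublePureL :
    ContinuousMultilinearMap ℂ (fun _ : Fin (n + 1) ⊕ Fin (n + 1) => H) (DoubleHistSpace H n) :=
  MultilinearMap.mkContinuous
    { toFun := doublePure
      map_update_add' := fun {inst} w s u v => by
        rw [Subsingleton.elim inst instDecidableEqSum]
        rcases s with i | i
        · simp only [doublePure_update_inl, pureTensor_update_add, htmul_add_left]
        · simp only [doublePure_update_inr, pureTensor_update_add, htmul_add_right]
      map_update_smul' := fun {inst} w s c u => by
        rw [Subsingleton.elim inst instDecidableEqSum]
        rcases s with i | i
        · simp only [doublePure_update_inl, pureTensor_update_smul, htmul_smul_left]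
        · simp only [doublePure_update_inr, pureTensor_update_smul, htmul_smul_right] }
    1 fun w => by rw [one_mul]; exact (norm_doublePure w).le

@[simp] lemma doublePureL_apply (w : Fin (n + 1) ⊕ Fin (n + 1) → H) :
    doublePureL H n w = doublePure w := rfl

lemma doubleHist_clm_ext {G : Type*} [NormedAddCommGroup G] [NormedSpace ℂ G]
    {f g : DoubleHistSpace H n →L[ℂ] G} (h : ∀ w, f (doublePure w) = g (doublePure w)) :
    f = g := by
  refine htensor_clm_ext fun u v => ?_
  have h₁ : ∀ x, f ∘L htmulL (pureTensor n x) = g ∘L htmulL (pureTensor n x) := fun x =>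
    histSpace_clm_ext n fun y => h (Sum.elim x y)
  have h₂ : f ∘L htmulL.flip v = g ∘L htmulL.flip v :=
    histSpace_clm_ext n fun x => congrArg (fun f => f v) (h₁ x)
  exact congrArg (fun f => f u) h₂

/-- Two operators with the same matrix elements between product vectors are equal. -/
lemma doubleHist_op_ext {M N : DoubleHistSpace H n →L[ℂ] DoubleHistSpace H n}
    (h : ∀ w w', ⟪doublePure w', M (doublePure w)⟫_ℂ = ⟪doublePure w', N (doublePure w)⟫_ℂ) :
    M = N := by
  refine doubleHist_clm_ext fun w => ext_inner_right ℂ fun z => ?_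
  have : innerSL ℂ (M (doublePure w)) = innerSL ℂ (N (doublePure w)) :=
    doubleHist_clm_ext fun w' => by
      simpa using congrArg conj (h w w')
  simpa using congrArg (fun f => f z) this

variable {ι : Type*}

lemma orthonormal_doublePure (e : Fin (n + 1) ⊕ Fin (n + 1) → HilbertBasis ι ℂ H) :
    Orthonormal ℂ fun j : Fin (n + 1) ⊕ Fin (n + 1) → ι => doublePure fun s => e s (j s) := by
  classical
  rw [orthonormal_iff_ite]
  intro j k
  simp only [inner_doublePure, orthonormal_iff_ite.mp (e _).orthonormal, Finset.prod_ite_zero,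
    Finset.prod_const_one, Finset.mem_univ, true_implies, funext_iff]

/-- The orthonormal basis of product vectors made of orthonormal bases of the factors. -/
def doubleBasis (e : Fin (n + 1) ⊕ Fin (n + 1) → HilbertBasis ι ℂ H) :
    HilbertBasis (Fin (n + 1) ⊕ Fin (n + 1) → ι) ℂ (DoubleHistSpace H n) :=
  HilbertBasis.mkOfOrthogonalEqBot (orthonormal_doublePure e) <| by
    rw [Submodule.eq_bot_iff]
    intro z hz
    -- Completeness: if `z` is orthogonal to all basis products, the multilinear map `w ↦ ⟪z,
    -- doublePure w⟫` vanishes on basis vectors, hence everywhere, and product vectors are total.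
    have h₁ : (innerSL ℂ z).compContinuousMultilinearMap (doublePureL H n) = 0 :=
      cmm_ext_hilbertBasis e fun j =>
        (Submodule.mem_orthogonal' _ z).mp hz _ (Submodule.subset_span ⟨j, rfl⟩)
    have h₂ : innerSL ℂ z = 0 := doubleHist_clm_ext fun w => congrArg (fun f => f w) h₁
    exact inner_self_eq_zero.mp (congrArg (fun f => f z) h₂)

lemma doubleBasis_apply (e : Fin (n + 1) ⊕ Fin (n + 1) → HilbertBasis ι ℂ H)
    (j : Fin (n + 1) ⊕ Fin (n + 1) → ι) : doubleBasis e j = doublePure fun s => e s (j s) := by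
  rw [doubleBasis, HilbertBasis.coe_mkOfOrthogonalEqBot]

end DoublePure

/-! ### The cyclic permutation of factors, the operator `ilsOp`, and ILS data. -/

section Cyclic

variable {H : Type*} [NormedAddCommGroup H] [InnerProductSpace ℂ H] [CompleteSpace H] {n : ℕ}

/-- Relabelling multi-indices by `j ↦ j ∘ τ` permutes a product basis, which defines a unitary. It
permutes the factors of every product vector because both sides are continuous and multilinear and
agree on basis vectors. -/
lemma exists_permute_factors (τ : Equiv.Perm (Fin (n + 1) ⊕ Fin (n + 1))) :
    ∃ U : DoubleHistSpace H n ≃ₗᵢ[ℂ] DoubleHistSpace H n,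
      ∀ w, U (doublePure w) = doublePure fun s => w (τ s) := by
  classical
  let b : HilbertBasis _ ℂ (DoubleHistSpace H n) := doubleBasis fun _ => chosenBasis H
  let φ := Equiv.arrowCongr τ.symm (Equiv.refl (basisIndex H))
  let c : HilbertBasis _ ℂ (DoubleHistSpace H n) :=
    HilbertBasis.mk (b.orthonormal.comp φ φ.injective) <| by
      rw [φ.surjective.range_comp]; exact b.dense_span.ge
  let U := b.repr.trans c.repr.symm
  have hU : ∀ j, U (b j) = b (φ j) := fun j => by
    rw [LinearIsometryEquiv.trans_apply, b.repr_self, c.repr_symm_single, HilbertBasis.coe_mk]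
    rfl
  refine ⟨U, fun w => ?_⟩
  have : (U.toLinearIsometry.toContinuousLinearMap).compContinuousMultilinearMap
      (doublePureL H n) = (doublePureL H n).domDomCongr τ := by
    refine cmm_ext_hilbertBasis (fun _ => chosenBasis H) fun j => ?_
    have := hU j
    simp only [b, doubleBasis_apply] at this
    exact this
  exact congrArg (fun f => f w) this

/-- The permutation of the `2 (n + 1)` tensor factors that turns the bra vectors of an ILS series
into its ket vectors. -/
def cyclicPerm (n : ℕ) : Equiv.Perm (Fin (n + 1) ⊕ Fin (n + 1)) where
  toFun := Sum.elim (Fin.cons (.inr 0) fun k => .inl k.castSucc)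
    (Fin.snoc (fun k => .inr k.succ) (.inl (Fin.last n)))
  invFun := Sum.elim (Fin.snoc (fun k => .inl k.succ) (.inr (Fin.last n)))
    (Fin.cons (.inl 0) fun k => .inr k.castSucc)
  left_inv := by
    rintro (i | i)
    · induction i using Fin.cases <;> simp
    · induction i using Fin.lastCases <;> simp
  right_inv := by
    rintro (i | i)
    · induction i using Fin.lastCases <;> simp
    · induction i using Fin.cases <;> simp

/-- The unitary operator that permutes the tensor factors by `cyclicPerm`. -/
def cyclicShift (H : Type*) [NormedAddCommGroup H] [InnerProductSpace ℂ H] [CompleteSpace H]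
    (n : ℕ) : DoubleHistSpace H n ≃ₗᵢ[ℂ] DoubleHistSpace H n :=
  (exists_permute_factors (cyclicPerm n)).choose

/-- The product vector `(x₀ ⊗ ⋯ ⊗ xₙ₋₁ ⊗ l) ⊗ (a ⊗ y₀ ⊗ ⋯ ⊗ yₙ₋₁)`. -/
def cycBra (a l : H) (x y : Fin n → H) : DoubleHistSpace H n :=
  htmul (pureTensor n (Fin.snoc (α := fun _ => H) x l))
    (pureTensor n (Fin.cons (α := fun _ => H) a y))

/-- The product vector `(a ⊗ x₀ ⊗ ⋯ ⊗ xₙ₋₁) ⊗ (y₀ ⊗ ⋯ ⊗ yₙ₋₁ ⊗ l)`. -/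
def cycKet (a l : H) (x y : Fin n → H) : DoubleHistSpace H n :=
  htmul (pureTensor n (Fin.cons (α := fun _ => H) a x))
    (pureTensor n (Fin.snoc (α := fun _ => H) y l))

/-- The shape `cycBra` is no restriction, so operators may be tested on such vectors alone
(`cyc_clm_ext`). -/
lemma htmul_pureTensor_eq_cycBra (x y : Fin (n + 1) → H) :
    htmul (pureTensor n x) (pureTensor n y) =
      cycBra (y 0) (x (Fin.last n)) (Fin.init x) (Fin.tail y) := by
  rw [cycBra, Fin.snoc_init_self, Fin.cons_self_tail]

lemma cyclicShift_cycBra (a l : H) (x y : Fin n → H) :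
    cyclicShift H n (cycBra a l x y) = cycKet a l x y := by
  rw [cycBra, ← doublePure_elim, cyclicShift, (exists_permute_factors (cyclicPerm n)).choose_spec,
    doublePure, cycKet]
  congr 2 <;> ext i
  · induction i using Fin.cases <;> simp [cyclicPerm]
  · induction i using Fin.lastCases <;> simp [cyclicPerm]

lemma cyc_clm_ext {G : Type*} [NormedAddCommGroup G] [NormedSpace ℂ G]
    {f g : DoubleHistSpace H n →L[ℂ] G}
    (h : ∀ a l x y, f (cycBra a l x y) = g (cycBra a l x y)) : f = g :=
  doubleHist_clm_ext fun w => by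
    rw [doublePure, htmul_pureTensor_eq_cycBra]; exact h _ _ _ _

variable (n) in
/-- The operator that acts by `A` on the factor `a` of `cycBra a l x y`. -/
def midOp (A : H →L[ℂ] H) : DoubleHistSpace H n →L[ℂ] DoubleHistSpace H n :=
  opTensor 1 (pureOp n (Function.update 1 0 A))

lemma midOp_cycBra (A : H →L[ℂ] H) (a l : H) (x y : Fin n → H) :
    midOp n A (cycBra a l x y) = cycBra (A a) l x y := by
  rw [midOp, cycBra, opTensor_htmul, pureOp_pureTensor, cycBra]
  congr 2
  ext i
  induction i using Fin.cases <;> simp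

lemma norm_midOp_le (A : H →L[ℂ] H) : ‖midOp n A‖ ≤ ‖A‖ := by
  refine (norm_opTensor_le _ _).trans ?_
  refine (mul_le_of_le_one_left (norm_nonneg _) ContinuousLinearMap.norm_id_le).trans ?_
  refine (norm_pureOp_le _ _).trans ?_
  rw [Fin.prod_univ_succ, Function.update_self]
  refine mul_le_of_le_one_right (norm_nonneg _) (Finset.prod_le_one (fun _ _ => norm_nonneg _) ?_)
  intro i _
  rw [Function.update_of_ne (Fin.succ_ne_zero i)]
  exact ContinuousLinearMap.norm_id_le

lemma midOp_comp (A B : H →L[ℂ] H) : midOp n A ∘L midOp n B = midOp n (A ∘L B) :=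
  cyc_clm_ext fun a l x y => by simp [midOp_cycBra]

lemma inner_cycBra (a l a' l' : H) (x y x' y' : Fin n → H) :
    ⟪cycBra a l x y, cycBra a' l' x' y'⟫_ℂ =
      ⟪a, a'⟫_ℂ * ⟪l, l'⟫_ℂ * (∏ i, ⟪x i, x' i⟫_ℂ) * ∏ i, ⟪y i, y' i⟫_ℂ := by
  rw [cycBra, cycBra, inner_htmul, inner_pureTensor, inner_pureTensor, Fin.prod_univ_castSucc,
    Fin.prod_univ_succ]
  simp only [Fin.snoc_castSucc, Fin.snoc_last, Fin.cons_zero, Fin.cons_succ]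
  ring

lemma adjoint_midOp (A : H →L[ℂ] H) : (midOp n A).adjoint = midOp n A.adjoint := by
  refine cyc_clm_ext fun a l x y => ext_inner_right ℂ fun z => ?_
  have : innerSL ℂ ((midOp n A).adjoint (cycBra a l x y)) =
      innerSL ℂ (midOp n A.adjoint (cycBra a l x y)) :=
    cyc_clm_ext fun a' l' x' y' => by
      simp only [innerSL_apply_apply, ContinuousLinearMap.adjoint_inner_left, midOp_cycBra,
        inner_cycBra]
  exact congrArg (fun f => f z) this

variable (n) in
/-- The operator of the pseudo-ILS representation. -/
def ilsOp (ρ : H →L[ℂ] H) : DoubleHistSpace H n →L[ℂ] DoubleHistSpace H n :=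
  (cyclicShift H n).toLinearIsometry.toContinuousLinearMap ∘L midOp n ρ

lemma ilsOp_apply (ρ : H →L[ℂ] H) (z : DoubleHistSpace H n) :
    ilsOp n ρ z = cyclicShift H n (midOp n ρ z) := rfl

lemma ilsOp_cycBra (ρ : H →L[ℂ] H) (a l : H) (x y : Fin n → H) :
    ilsOp n ρ (cycBra a l x y) = cycKet (ρ a) l x y := by
  rw [ilsOp_apply, midOp_cycBra, cyclicShift_cycBra]

lemma norm_ilsOp_apply_le {ρ : H →L[ℂ] H} (hρ : ‖ρ‖ ≤ 1) (z : DoubleHistSpace H n) :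
    ‖ilsOp n ρ z‖ ≤ ‖z‖ := by
  rw [ilsOp_apply, LinearIsometryEquiv.norm_map]
  simpa using (midOp n ρ).le_of_opNorm_le ((norm_midOp_le ρ).trans hρ) z

/-- With `m = n + 1` and numbering from zero, `v 0` is `e¹` and `v (n + 1)` is `eᵐ⁺¹`. The remaining
factors keep their relative order when passing from bra to ket. -/
lemma ilsBra_eq (v : Fin (2 * (n + 1)) → H) :
    ilsBra v = cycBra (v 0) (v ⟨n + 1, by omega⟩) (fun k => v ⟨2 * n + 1 - k, by omega⟩)
      (fun k => v ⟨k + 1, by omega⟩) := by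
  rw [ilsBra, htmul_pureTensor_eq_cycBra]
  congr 2
  rw [Fin.mk.injEq, Fin.val_last]
  omega

lemma ilsKet_eq (v : Fin (2 * (n + 1)) → H) :
    ilsKet v = cycKet (v 0) (v ⟨n + 1, by omega⟩) (fun k => v ⟨2 * n + 1 - k, by omega⟩)
      (fun k => v ⟨k + 1, by omega⟩) := by
  rw [ilsKet, cycKet]
  congr 2 <;> ext i
  · induction i using Fin.cases with
    | zero => simp
    | succ i =>
      simp only [Fin.succ_ne_zero, if_false, Fin.cons_succ]
      congr 1
      ext
      simp only [Fin.ofNat, Fin.val_succ]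
      -- The reduction modulo `2 (n + 1)` in `Fin.ofNat` is void here, since the position in the ket
      -- is at least one.
      rw [Nat.mod_eq_of_lt] <;> omega
  · induction i using Fin.lastCases <;> simp

/-- The position in `e¹, …, e²ᵐ` of the factors of the bra vectors of an ILS series. -/
def braEquiv (n : ℕ) : Fin (n + 1) ⊕ Fin (n + 1) ≃ Fin (2 * (n + 1)) :=
  Equiv.ofBijective
    (Sum.elim (fun k => ⟨2 * n + 1 - k, by omega⟩) fun k => ⟨k, by omega⟩) <| by
    rw [Fintype.bijective_iff_injective_and_card]
    refine ⟨?_, by simp; omega⟩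
    rintro (i | i) (k | k) h <;> simp [Fin.ext_iff] at h ⊢ <;> omega

variable {ρ : H →L[ℂ] H} {ι : Type*}

lemma ILSData.bra_eq (D : ILSData ρ n ι) (j : Fin (2 * (n + 1)) → ι) :
    D.bra j = doubleBasis (fun s => D.e (braEquiv n s)) (fun s => j (braEquiv n s)) := by
  rw [doubleBasis_apply]
  rfl

/-- The link between the series and the operator, and the only use of the fact that `e¹`
diagonalizes `ρ`. -/
lemma ILSData.ilsOp_bra (D : ILSData ρ n ι) (j : Fin (2 * (n + 1)) → ι) :
    ilsOp n ρ (D.bra j) = D.coeff j • D.ket j := by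
  rw [ILSData.bra, ilsBra_eq, ilsOp_cycBra, D.spectral, ILSData.ket, ilsKet_eq, ILSData.coeff,
    cycKet, cycKet, ← htmul_smul_left]
  congr 1
  -- Writing `Fin.cons` as an update of slot `0` makes homogeneity in one slot applicable.
  have h : ∀ a : H, ∀ x : Fin n → H, Fin.cons (α := fun _ => H) a x =
      Function.update (Fin.cons (α := fun _ => H) 0 x) 0 a := fun a x => by simp
  rw [h, pureTensor_update_smul, ← h]

/-- The bra vectors of an ILS series form an orthonormal basis, indexed by reordered
multi-indices. -/
lemma ILSData.hasSum_iff {G : Type*} [AddCommMonoid G] [TopologicalSpace G] (D : ILSData ρ n ι)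
    (f : DoubleHistSpace H n → G) (g : G) :
    HasSum (fun j => f (D.bra j)) g ↔
      HasSum (fun j => f (doubleBasis (fun s => D.e (braEquiv n s)) j)) g := by
  rw [← (Equiv.arrowCongr (braEquiv n).symm (Equiv.refl ι)).hasSum_iff]
  simp only [D.bra_eq]
  rfl

end Cyclic

/-! ### Traces against finite rank operators, trace class estimates, density operators. -/

section Trace

variable {E : Type*} [NormedAddCommGroup E] [InnerProductSpace ℂ E] [CompleteSpace E]

/-- Parseval for `Q* η` and `P* ξ`. Keeping both `P` and `Q` covers the trace (`P = X*`, `Q = 1`),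
the ILS series (`P = 1`, `Q = X`) and the symmetric splitting in the Gram formula. -/
lemma hasSum_inner_rankOne {ι : Type*} (B : HilbertBasis ι ℂ E) (P Q : E →L[ℂ] E) (ξ η : E) :
    HasSum (fun j => ⟪P (B j), InnerProductSpace.rankOne ℂ ξ η (Q (B j))⟫_ℂ)
      ⟪η, Q (P.adjoint ξ)⟫_ℂ := by
  have := B.hasSum_inner_mul_inner (Q.adjoint η) (P.adjoint ξ)
  rw [ContinuousLinearMap.adjoint_inner_left] at this
  simpa only [ContinuousLinearMap.adjoint_inner_left, ContinuousLinearMap.adjoint_inner_right,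
    InnerProductSpace.rankOne_apply, inner_smul_right] using this

lemma opTrace_comp_rankOne (X : E →L[ℂ] E) (ξ η : E) :
    opTrace (X ∘L InnerProductSpace.rankOne ℂ ξ η) = ⟪η, X ξ⟫_ℂ := by
  have := hasSum_inner_rankOne (chosenBasis E) X.adjoint 1 ξ η
  simp only [ContinuousLinearMap.adjoint_inner_left, ContinuousLinearMap.adjoint_adjoint] at this
  exact this.tsum_eq

/-- For `T` in `F(E) ⊗_alg F(E)` the trace of `X T` can be computed in every orthonormal basis,
and `X` can be distributed to both sides of `T`. -/
lemma hasSum_opTrace {ι : Type*} (B : HilbertBasis ι ℂ (HTensor E E))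
    {P Q X T : HTensor E E →L[ℂ] HTensor E E} (h : Q ∘L P.adjoint = X)
    (hT : T ∈ finRankTensor E) :
    HasSum (fun j => ⟪P (B j), T (Q (B j))⟫_ℂ) (opTrace (X ∘L T)) := by
  -- Requiring both sums to exist with a common value gives a condition linear in `T`, so the rank
  -- one case suffices.
  have key : ∃ t, HasSum (fun j => ⟪P (B j), T (Q (B j))⟫_ℂ) t ∧
      HasSum (fun i => ⟪chosenBasis (HTensor E E) i, X (T (chosenBasis (HTensor E E) i))⟫_ℂ) t := by
    refine finRankTensor_induction (P := fun T => ∃ t,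
      HasSum (fun j => ⟪P (B j), T (Q (B j))⟫_ℂ) t ∧
      HasSum (fun i => ⟪chosenBasis (HTensor E E) i, X (T (chosenBasis (HTensor E E) i))⟫_ℂ) t)
      ⟨0, ?_, ?_⟩ ?_ ?_ ?_ hT
    · simp
    · simp
    · rintro S T ⟨s, hs, hs'⟩ ⟨t, ht, ht'⟩
      refine ⟨s + t, ?_, ?_⟩
      · simpa [inner_add_right] using hs.add ht
      · simpa [inner_add_right] using hs'.add ht'
    · rintro c T ⟨t, ht, ht'⟩
      refine ⟨c * t, ?_, ?_⟩
      · simpa [inner_smul_right] using ht.mul_left c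
      · simpa [inner_smul_right] using ht'.mul_left c
    · intro ξ η
      refine ⟨_, hasSum_inner_rankOne B P Q ξ η, ?_⟩
      have := hasSum_inner_rankOne (chosenBasis (HTensor E E)) X.adjoint 1 ξ η
      simp only [ContinuousLinearMap.adjoint_inner_left, ContinuousLinearMap.adjoint_adjoint]
        at this
      rw [← h] at this
      rw [← h]
      exact this
  obtain ⟨t, ht, ht'⟩ := key
  have : opTrace (X ∘L T) = t := ht'.tsum_eq
  rwa [this]

lemma hasSum_opTrace_right {ι : Type*} (B : HilbertBasis ι ℂ (HTensor E E))
    (X : HTensor E E →L[ℂ] HTensor E E) {T : HTensor E E →L[ℂ] HTensor E E}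
    (hT : T ∈ finRankTensor E) :
    HasSum (fun j => ⟪B j, X (T (B j))⟫_ℂ) (opTrace (X ∘L T)) := by
  have := hasSum_opTrace B (P := X.adjoint) (Q := 1) (X := X) (by
    rw [ContinuousLinearMap.adjoint_adjoint]; rfl) hT
  simp only [ContinuousLinearMap.adjoint_inner_left] at this
  exact this

/-- The functional `T ↦ tr (X T)` on `F(E) ⊗_alg F(E)`. -/
def traceForm (X : HTensor E E →L[ℂ] HTensor E E) : finRankTensor E →ₗ[ℂ] ℂ where
  toFun T := opTrace (X ∘L T.1)
  map_add' S T := by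
    have h := (hasSum_opTrace_right (chosenBasis _) X S.2).add
      (hasSum_opTrace_right (chosenBasis _) X T.2)
    rw [← h.tsum_eq]
    simp [opTrace]
  map_smul' c T := by
    have h := (hasSum_opTrace_right (chosenBasis _) X T.2).mul_left c
    rw [RingHom.id_apply, smul_eq_mul, ← h.tsum_eq]
    simp [opTrace]

lemma norm_abs_apply (T : E →L[ℂ] E) (x : E) : ‖CFC.abs T x‖ = ‖T x‖ := by
  have h₁ : (CFC.abs T).adjoint = CFC.abs T := (IsSelfAdjoint.of_nonneg (CFC.abs_nonneg T)).star_eq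
  have h : ⟪CFC.abs T x, CFC.abs T x⟫_ℂ = ⟪T x, T x⟫_ℂ := by
    rw [← ContinuousLinearMap.adjoint_inner_right, h₁, ← ContinuousLinearMap.adjoint_inner_right]
    exact congrArg (fun S : E →L[ℂ] E => ⟪x, S x⟫_ℂ) (CFC.abs_mul_abs T)
  rw [inner_self_eq_norm_sq_to_K, inner_self_eq_norm_sq_to_K] at h
  exact (sq_eq_sq₀ (norm_nonneg _) (norm_nonneg _)).mp (by exact_mod_cast h)

/-- Since `‖|T| x‖ = ‖T x‖`, the identity `T P = T` passes to `|T| P = |T|`; the diagonal of `|T|`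
is then covered by the hypothesis at `A = |T|`. -/
lemma isTraceClass_of_comp_eq {T P : E →L[ℂ] E} (hTP : T ∘L P = T)
    (h : ∀ A : E →L[ℂ] E, Summable fun i => ⟪chosenBasis E i, A (P (chosenBasis E i))⟫_ℂ) :
    IsTraceClass T := by
  have h' : ∀ z, CFC.abs T (P z) = CFC.abs T z := fun z => by
    rw [← sub_eq_zero, ← map_sub, ← norm_eq_zero, norm_abs_apply, map_sub, norm_eq_zero,
      sub_eq_zero]
    exact congrArg (fun S => S z) hTP
  have := h (CFC.abs T)
  simp only [h'] at this
  exact this.mapL Complex.reCLM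

lemma isTraceClass_comp_opTensor (X : HTensor E E →L[ℂ] HTensor E E) (p q : FinRankProj E) :
    IsTraceClass (X ∘L opTensor p.1 q.1) := by
  refine isTraceClass_of_comp_eq (P := opTensor p.1 q.1) ?_ fun A =>
    (hasSum_opTrace_right _ A (opTensor_mem p.2.2 q.2.2)).summable
  rw [ContinuousLinearMap.comp_assoc, opTensor_comp]
  congr 2
  exacts [p.2.1.isIdempotentElem, q.2.1.isIdempotentElem]

lemma exists_sqrt {A : E →L[ℂ] E} (hA : A.IsPositive) :
    ∃ S : E →L[ℂ] E, S.adjoint = S ∧ S ∘L S = A := by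
  have hA' : 0 ≤ A := ContinuousLinearMap.nonneg_iff_isPositive A |>.mpr hA
  exact ⟨CFC.sqrt A, (IsSelfAdjoint.of_nonneg (CFC.sqrt_nonneg A)).star_eq,
    CFC.sqrt_mul_sqrt_self A hA'⟩

lemma re_inner_of_sqrt {A S : E →L[ℂ] E} (hS : S.adjoint = S) (hSS : S ∘L S = A) (x : E) :
    RCLike.re ⟪x, A x⟫_ℂ = ‖S x‖ ^ 2 := by
  rw [← hSS, ContinuousLinearMap.comp_apply, ← ContinuousLinearMap.adjoint_inner_left, hS,
    inner_self_eq_norm_sq]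

lemma hasSum_norm_inner_sq {E ι : Type*} [NormedAddCommGroup E] [InnerProductSpace ℂ E] (B : HilbertBasis ι ℂ E) (x : E) :
    HasSum (fun i => ‖⟪B i, x⟫_ℂ‖ ^ 2) (‖x‖ ^ 2) := by
  have := (B.hasSum_inner_mul_inner x x).mapL Complex.reCLM
  rw [Complex.reCLM_apply, ← RCLike.re_eq_complex_re, inner_self_eq_norm_sq] at this
  convert this using 2 with i
  rw [← inner_conj_symm x, RCLike.conj_mul, Complex.reCLM_apply]
  norm_cast

/-- The partial traces of a positive trace class operator are bounded by its trace. -/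
lemma sum_norm_sq_le_trace {A S : E →L[ℂ] E} (hS : S.adjoint = S) (hSS : S ∘L S = A)
    (hA : Summable fun i => RCLike.re ⟪chosenBasis E i, A (chosenBasis E i)⟫_ℂ)
    {κ : Type*} [Fintype κ] {z : κ → E} (hz : Orthonormal ℂ z) :
    ∑ l, ‖S (z l)‖ ^ 2 ≤ ∑' i, RCLike.re ⟪chosenBasis E i, A (chosenBasis E i)⟫_ℂ := by
  refine hasSum_le (fun i => ?_)
    (hasSum_sum fun l _ => hasSum_norm_inner_sq (chosenBasis E) (S (z l))) hA.hasSum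
  rw [re_inner_of_sqrt hS hSS]
  -- After Parseval for each `S (z l)`, Bessel's inequality for `z` bounds the sum over `l` by `‖S
  -- e_i‖²`, the diagonal entry of `A`.
  refine le_trans (Finset.sum_le_sum fun l _ => ?_)
    (hz.sum_inner_products_le (S (chosenBasis E i)) (s := Finset.univ))
  rw [← ContinuousLinearMap.adjoint_inner_left, hS, norm_inner_symm]

/-- Trace class implies Hilbert–Schmidt: with `S = |T|^(1/2)` one has `‖T z‖ = ‖S (S z)‖ ≤ ‖S‖ ‖S
z‖`, whence the constant `‖S‖² tr |T|`. -/
lemma IsTraceClass.exists_sum_norm_sq_le {T : E →L[ℂ] E} (hT : IsTraceClass T) :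
    ∃ C : ℝ, ∀ {κ : Type*} [Fintype κ] {z : κ → E}, Orthonormal ℂ z → ∑ l, ‖T (z l)‖ ^ 2 ≤ C := by
  obtain ⟨S, hS, hSS⟩ := exists_sqrt
    ((ContinuousLinearMap.nonneg_iff_isPositive _).mp (CFC.abs_nonneg T))
  refine ⟨‖S‖ ^ 2 * ∑' i, RCLike.re ⟪chosenBasis E i, CFC.abs T (chosenBasis E i)⟫_ℂ,
    fun {κ} _ z hz => ?_⟩
  refine le_trans ?_ (mul_le_mul_of_nonneg_left (sum_norm_sq_le_trace hS hSS hT hz) (sq_nonneg _))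
  rw [Finset.mul_sum]
  gcongr with l
  rw [← norm_abs_apply, ← mul_pow, ← hSS]
  gcongr
  exact S.le_opNorm _

lemma IsDensityOperator.summable {ρ : E →L[ℂ] E} (hρ : IsDensityOperator ρ) :
    Summable fun i => RCLike.re ⟪chosenBasis E i, ρ (chosenBasis E i)⟫_ℂ := by
  have := hρ.isTraceClass
  rwa [IsTraceClass,
    CFC.abs_of_nonneg ρ ((ContinuousLinearMap.nonneg_iff_isPositive ρ).mpr hρ.isPositive)] at this

lemma IsDensityOperator.tsum_eq_one {ρ : E →L[ℂ] E} (hρ : IsDensityOperator ρ) :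
    ∑' i, RCLike.re ⟪chosenBasis E i, ρ (chosenBasis E i)⟫_ℂ = 1 := by
  have h := hρ.trace_eq_one
  have hre : ∀ i, ⟪chosenBasis E i, ρ (chosenBasis E i)⟫_ℂ =
      ((RCLike.re ⟪chosenBasis E i, ρ (chosenBasis E i)⟫_ℂ : ℝ) : ℂ) := fun i => by
    obtain ⟨S, hS, hSS⟩ := exists_sqrt hρ.isPositive
    rw [re_inner_of_sqrt hS hSS, ← hSS, ContinuousLinearMap.comp_apply,
      ← ContinuousLinearMap.adjoint_inner_left, hS, inner_self_eq_norm_sq_to_K]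
    norm_cast
  rw [opTrace, tsum_congr hre, ← Complex.ofReal_tsum] at h
  exact_mod_cast h

lemma IsDensityOperator.norm_le_one {ρ : E →L[ℂ] E} (hρ : IsDensityOperator ρ) : ‖ρ‖ ≤ 1 := by
  obtain ⟨S, hS, hSS⟩ := exists_sqrt hρ.isPositive
  have hS1 : ‖S‖ ≤ 1 := by
    refine S.opNorm_le_of_unit_norm zero_le_one fun x hx => ?_
    -- A unit vector is an orthonormal family with one member, so `‖S x‖² ≤ tr ρ = 1`.
    have := sum_norm_sq_le_trace hS hSS hρ.summable (κ := Unit) (z := fun _ => x)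
      ⟨fun _ => hx, fun _ _ h => absurd rfl h⟩
    rw [hρ.tsum_eq_one] at this
    simpa using this
  rw [← hSS]
  exact (S.opNorm_comp_le S).trans (mul_le_one₀ hS1 (norm_nonneg _) hS1)

lemma IsDensityOperator.ne_zero {ρ : E →L[ℂ] E} (hρ : IsDensityOperator ρ) : ρ ≠ 0 := by
  rintro rfl
  simpa [opTrace] using hρ.trace_eq_one

end Trace

/-! ### Failure of the trace class property in infinite dimension. -/

section NotTraceClass

variable {H : Type*} [NormedAddCommGroup H] [InnerProductSpace ℂ H] [CompleteSpace H] {n : ℕ}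

lemma orthonormal_cycBra {κ : Type*} {e : κ → H} (he : Orthonormal ℂ e) {a : H} (ha : ‖a‖ = 1) :
    Orthonormal ℂ fun l => (cycBra a (e l) (fun _ => a) (fun _ => a) : DoubleHistSpace H n) := by
  classical
  rw [orthonormal_iff_ite] at he ⊢
  intro i j
  have : ⟪a, a⟫_ℂ = 1 := by rw [inner_self_eq_norm_sq_to_K, ha]; simp
  simp only [inner_cycBra, this, he, Finset.prod_const_one, mul_one, one_mul]

lemma norm_cycKet (a l : H) (x y : Fin n → H) :
    ‖cycKet a l x y‖ = ‖a‖ * ‖l‖ * (∏ i, ‖x i‖) * ∏ i, ‖y i‖ := by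
  rw [cycKet, norm_htmul, norm_pureTensor, norm_pureTensor, Fin.prod_univ_succ,
    Fin.prod_univ_castSucc]
  simp only [Fin.snoc_castSucc, Fin.snoc_last, Fin.cons_zero, Fin.cons_succ]
  ring

/-- With `ρ a ≠ 0` fixed in slot `a`, letting `l` run through `N` orthonormal vectors gives an
orthonormal family whose images all have norm `‖ρ a‖`. Thus `N ‖ρ a‖²` would be bounded in `N`. -/
lemma not_isTraceClass_ilsOp {ρ : H →L[ℂ] H} (hρ : ρ ≠ 0) (hH : ¬ FiniteDimensional ℂ H) :
    ¬ IsTraceClass (ilsOp n ρ) := by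
  intro htr
  obtain ⟨a, ha, hρa⟩ : ∃ a : H, ‖a‖ = 1 ∧ ρ a ≠ 0 := by
    obtain ⟨a, ha⟩ : ∃ a, ρ a ≠ 0 := by
      by_contra! h
      exact hρ (ContinuousLinearMap.ext h)
    have ha0 : a ≠ 0 := by rintro rfl; simp at ha
    refine ⟨(‖a‖⁻¹ : ℂ) • a, norm_smul_inv_norm ha0, ?_⟩
    rw [map_smul]
    exact smul_ne_zero (by simpa using ha0) ha
  have hinf : Infinite (basisIndex H) := by
    by_contra hfin
    have := not_infinite_iff_finite.mp hfin
    have := Fintype.ofFinite (basisIndex H)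
    exact hH (chosenBasis H).toOrthonormalBasis.toBasis.finiteDimensional_of_finite
  obtain ⟨C, hC⟩ := htr.exists_sum_norm_sq_le
  have hle : ∀ N : ℕ, N * ‖ρ a‖ ^ 2 ≤ C := fun N => by
    obtain ⟨s, hs⟩ := Infinite.exists_subset_card_eq (basisIndex H) N
    have h := hC (orthonormal_cycBra (n := n)
      ((chosenBasis H).orthonormal.comp _ (Subtype.val_injective (p := (· ∈ s)))) ha)
    simpa [ilsOp_cycBra, norm_cycKet, ha, (chosenBasis H).orthonormal.1, hs] using h
  have hpos : 0 < ‖ρ a‖ ^ 2 := by positivity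
  obtain ⟨N, hN⟩ := exists_nat_gt (C / ‖ρ a‖ ^ 2)
  rw [div_lt_iff₀ hpos] at hN
  exact absurd (hle N) (not_le.mpr hN)

end NotTraceClass

/-! ### Ordered operator products as multilinear maps. -/

section ListProduct

variable {H : Type*} [NormedAddCommGroup H] [InnerProductSpace ℂ H] {n : ℕ}

variable (H) in
/-- The multilinear map `h ↦ h₀ h₁ ⋯ hₙ`. -/
def prodM (n : ℕ) :
    MultilinearMap ℂ (fun _ : Fin (n + 1) => H →L[ℂ] H) (H →L[ℂ] H) :=
  MultilinearMap.mkPiAlgebraFin ℂ (n + 1) (H →L[ℂ] H)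

variable (H) in
/-- The multilinear map `h ↦ hₙ ⋯ h₁ h₀`. -/
def revProdM (n : ℕ) :
    MultilinearMap ℂ (fun _ : Fin (n + 1) => H →L[ℂ] H) (H →L[ℂ] H) :=
  (prodM H n).domDomCongr Fin.revPerm

lemma prodM_apply (h : Fin (n + 1) → (H →L[ℂ] H)) :
    prodM H n h = (List.ofFn h).prod :=
  MultilinearMap.mkPiAlgebraFin_apply _

lemma revProdM_apply (h : Fin (n + 1) → (H →L[ℂ] H)) :
    revProdM H n h = (List.ofFn h).reverse.prod := by
  have : (List.ofFn h).reverse = List.ofFn fun i => h (Fin.rev i) :=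
    List.ext_getElem (by simp) fun i _ _ => by
      simp only [List.getElem_reverse, List.getElem_ofFn, List.length_ofFn]
      congr 1
      ext
      simp only [Fin.val_rev]
      omega
  rw [this]
  exact prodM_apply _

lemma prodM_rankOne : ∀ (n : ℕ) (u v : Fin (n + 1) → H),
    prodM H n (fun i => InnerProductSpace.rankOne ℂ (u i) (v i)) =
      (∏ i : Fin n, ⟪v i.castSucc, u i.succ⟫_ℂ) •
        InnerProductSpace.rankOne ℂ (u 0) (v (Fin.last n))
  | 0, u, v => by simp [prodM_apply]
  | n + 1, u, v => by
    have := prodM_rankOne n (fun i => u i.succ) (fun i => v i.succ)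
    rw [prodM_apply] at this ⊢
    rw [List.ofFn_succ, List.prod_cons, this, Fin.prod_univ_succ]
    ext z
    simp [smul_smul]
    ring_nf

lemma revProdM_rankOne : ∀ (n : ℕ) (u v : Fin (n + 1) → H),
    revProdM H n (fun i => InnerProductSpace.rankOne ℂ (u i) (v i)) =
      (∏ i : Fin n, ⟪v i.succ, u i.castSucc⟫_ℂ) •
        InnerProductSpace.rankOne ℂ (u (Fin.last n)) (v 0)
  | 0, u, v => by simp [revProdM_apply]
  | n + 1, u, v => by
    have := revProdM_rankOne n (fun i => u i.succ) (fun i => v i.succ)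
    rw [revProdM_apply] at this ⊢
    rw [List.ofFn_succ, List.reverse_cons, List.prod_append, this, Fin.prod_univ_succ]
    ext z
    simp [smul_smul]
    ring_nf

end ListProduct

/-! ### The trace formula for homogeneous histories. -/

section Homogeneous

variable {H : Type*} [NormedAddCommGroup H] [InnerProductSpace ℂ H] [CompleteSpace H] {n : ℕ}

/-- Induction principle for families of finite rank operators: a property that is additive in each
factor holds for all of them if it holds for the families of rank one operators. -/
lemma finiteRank_family_induction {σ : Type*} [Fintype σ] [DecidableEq σ]
    {P : (σ → (H →L[ℂ] H)) → Prop} (zero : ∀ h i, P (Function.update h i 0))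
    (add : ∀ h i a b, P (Function.update h i a) → P (Function.update h i b) →
      P (Function.update h i (a + b)))
    (rankOne : ∀ u v : σ → H, P fun s => InnerProductSpace.rankOne ℂ (u s) (v s))
    {h : σ → (H →L[ℂ] H)} (hh : ∀ s, IsFiniteRank (h s)) : P h := by
  -- Outside `t` the factors are already of rank one; a slot of `t` is expanded into rank one
  -- operators.
  have key : ∀ (t : Finset σ) (h : σ → (H →L[ℂ] H)), (∀ s, IsFiniteRank (h s)) →
      (∀ s ∉ t, ∃ u v, InnerProductSpace.rankOne ℂ u v = h s) → P h := by
    intro t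
    induction t using Finset.induction_on with
    | empty =>
      intro h _ hr
      choose u v huv using fun s => hr s (Finset.notMem_empty s)
      simpa only [huv] using rankOne u v
    | insert s t _ ih =>
      intro h hh hr
      obtain ⟨r, u, v, huv⟩ := (hh s).exists_eq_sum
      rw [← Function.update_eq_self s h, huv]
      refine Finset.sum_induction (s := Finset.univ) _ (fun a => P (Function.update h s a))
        (add h s) (zero h s) fun i _ => ih _ (fun s' => ?_) fun s' hs' => ?_
      · by_cases hss : s' = s
        · subst hss; rw [Function.update_self]; exact isFiniteRank_rankOne _ _
        · rw [Function.update_of_ne hss]; exact hh s'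
      · by_cases hss : s' = s
        · subst hss; exact ⟨u i, v i, by rw [Function.update_self]⟩
        · rw [Function.update_of_ne hss]; exact hr s' (by simp [hss, hs'])
  exact key Finset.univ h hh fun s hs => absurd (Finset.mem_univ s) hs

lemma pureOp_update_pureTensor (h : Fin (n + 1) → (H →L[ℂ] H)) (i : Fin (n + 1)) (a : H →L[ℂ] H)
    (x : Fin (n + 1) → H) :
    pureOp n (Function.update h i a) (pureTensor n x) =
      pureTensor n (Function.update (fun k => h k (x k)) i (a (x i))) := by
  rw [pureOp_pureTensor]
  congr 1
  ext k
  by_cases hk : k = i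
  · subst hk; simp
  · simp [hk]

lemma pureOp_update_add (h : Fin (n + 1) → (H →L[ℂ] H)) (i : Fin (n + 1)) (a b : H →L[ℂ] H) :
    pureOp n (Function.update h i (a + b)) =
      pureOp n (Function.update h i a) + pureOp n (Function.update h i b) :=
  histSpace_clm_ext n fun x => by
    simp only [add_apply, pureOp_update_pureTensor, pureTensor_update_add]

lemma pureOp_update_zero (h : Fin (n + 1) → (H →L[ℂ] H)) (i : Fin (n + 1)) :
    pureOp n (Function.update h i 0) = 0 := by
  simpa using pureOp_update_add h i 0 0

lemma pureOp_rankOne (u v : Fin (n + 1) → H) :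
    pureOp n (fun i => InnerProductSpace.rankOne ℂ (u i) (v i)) =
      InnerProductSpace.rankOne ℂ (pureTensor n u) (pureTensor n v) :=
  histSpace_clm_ext n fun x => by
    rw [pureOp_pureTensor, InnerProductSpace.rankOne_apply, inner_pureTensor]
    exact (pureTensorL H n).map_smul_univ (fun i => ⟪v i, x i⟫_ℂ) u

lemma standardDF_eq (ρ : H →L[ℂ] H) (h k : Fin (n + 1) → (H →L[ℂ] H)) :
    standardDF ρ h k = opTrace (revProdM H n h * ρ * prodM H n k) := by
  rw [standardDF, revProdM_apply, prodM_apply]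

/-- These are exactly the contractions met in `tr (hₙ ⋯ h₀ ρ k₀ ⋯ kₙ)` for `h i = |u i⟩⟨v i|` and `k
i = |u' i⟩⟨v' i|`, which explains the choice of permutation. -/
lemma inner_ilsOp_pureTensor (ρ : H →L[ℂ] H) (u u' v v' : Fin (n + 1) → H) :
    ⟪htmul (pureTensor n v) (pureTensor n v'),
      ilsOp n ρ (htmul (pureTensor n u) (pureTensor n u'))⟫_ℂ =
      ⟪v 0, ρ (u' 0)⟫_ℂ * (∏ i : Fin n, ⟪v i.succ, u i.castSucc⟫_ℂ) *
        (∏ i : Fin n, ⟪v' i.castSucc, u' i.succ⟫_ℂ) * ⟪v' (Fin.last n), u (Fin.last n)⟫_ℂ := by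
  rw [htmul_pureTensor_eq_cycBra u, ilsOp_cycBra, cycKet, inner_htmul, inner_pureTensor,
    inner_pureTensor, Fin.prod_univ_succ, Fin.prod_univ_castSucc (n := n)]
  simp only [Fin.snoc_castSucc, Fin.snoc_last, Fin.cons_zero, Fin.cons_succ, Fin.init, Fin.tail]
  ring

/-- The trace formula for homogeneous histories, as a statement about the diagonals of the two
operators. -/
lemma exists_hasSum_homogeneous (ρ : H →L[ℂ] H) {h k : Fin (n + 1) → (H →L[ℂ] H)}
    (hh : ∀ i, IsFiniteRank (h i)) (hk : ∀ i, IsFiniteRank (k i)) :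
    ∃ t : ℂ, HasSum (fun i => ⟪chosenBasis H i,
        (revProdM H n h * ρ * prodM H n k) (chosenBasis H i)⟫_ℂ) t ∧
      HasSum (fun i => ⟪chosenBasis (DoubleHistSpace H n) i,
        ilsOp n ρ (opTensor (pureOp n h) (pureOp n k) (chosenBasis (DoubleHistSpace H n) i))⟫_ℂ)
        t := by
  -- Summability is carried through the induction because `opTrace`, a `tsum`, is additive only for
  -- summable diagonals. The induction runs over `h`, then over `k` with `h` of rank one.
  refine finiteRank_family_induction (P := fun h => ∃ t : ℂ, HasSum (fun i => ⟪chosenBasis H i,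
        (revProdM H n h * ρ * prodM H n k) (chosenBasis H i)⟫_ℂ) t ∧
      HasSum (fun i => ⟪chosenBasis (DoubleHistSpace H n) i,
        ilsOp n ρ (opTensor (pureOp n h) (pureOp n k) (chosenBasis (DoubleHistSpace H n) i))⟫_ℂ)
        t) ?_ ?_ ?_ hh
  · intro h i
    refine ⟨0, ?_, ?_⟩
    · simp [(revProdM H n).map_update_zero]
    · simp [pureOp_update_zero, opTensor_zero_left]
  · rintro h i a b ⟨s, hs, hs'⟩ ⟨t, ht, ht'⟩
    refine ⟨s + t, ?_, ?_⟩
    · simpa only [MultilinearMap.map_update_add, add_mul, add_apply, inner_add_right]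
        using hs.add ht
    · simpa only [pureOp_update_add, opTensor_add_left, add_apply, map_add, inner_add_right]
        using hs'.add ht'
  intro u v
  refine finiteRank_family_induction (P := fun k => ∃ t : ℂ, HasSum (fun i => ⟪chosenBasis H i,
        (revProdM H n (fun s => InnerProductSpace.rankOne ℂ (u s) (v s)) * ρ * prodM H n k)
          (chosenBasis H i)⟫_ℂ) t ∧
      HasSum (fun i => ⟪chosenBasis (DoubleHistSpace H n) i,
        ilsOp n ρ (opTensor (pureOp n fun s => InnerProductSpace.rankOne ℂ (u s) (v s))
          (pureOp n k) (chosenBasis (DoubleHistSpace H n) i))⟫_ℂ) t) ?_ ?_ ?_ hk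
  · intro k i
    refine ⟨0, ?_, ?_⟩
    · simp [(prodM H n).map_update_zero]
    · simp [pureOp_update_zero, opTensor_zero_right]
  · rintro k i a b ⟨s, hs, hs'⟩ ⟨t, ht, ht'⟩
    refine ⟨s + t, ?_, ?_⟩
    · simpa only [MultilinearMap.map_update_add, mul_add, add_apply, inner_add_right]
        using hs.add ht
    · simpa only [pureOp_update_add, opTensor_add_right, add_apply, map_add, inner_add_right]
        using hs'.add ht'
  intro u' v'
  refine ⟨⟪v 0, ρ (u' 0)⟫_ℂ * (∏ i : Fin n, ⟪v i.succ, u i.castSucc⟫_ℂ) *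
        (∏ i : Fin n, ⟪v' i.castSucc, u' i.succ⟫_ℂ) * ⟪v' (Fin.last n), u (Fin.last n)⟫_ℂ,
        ?_, ?_⟩
  · have h₁ := ((chosenBasis H).hasSum_inner_mul_inner (v' (Fin.last n)) (u (Fin.last n))).mul_left
      (⟪v 0, ρ (u' 0)⟫_ℂ * (∏ i : Fin n, ⟪v i.succ, u i.castSucc⟫_ℂ) *
        (∏ i : Fin n, ⟪v' i.castSucc, u' i.succ⟫_ℂ))
    refine h₁.congr_fun ?_
    intro i
    rw [revProdM_rankOne, prodM_rankOne]
    simp only [mul_apply_eq_comp, smul_apply, InnerProductSpace.rankOne_apply, map_smul,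
      inner_smul_right]
    ring
  · have h₁ := hasSum_inner_rankOne (chosenBasis (DoubleHistSpace H n)) (ilsOp n ρ).adjoint 1
      (htmul (pureTensor n u) (pureTensor n u')) (htmul (pureTensor n v) (pureTensor n v'))
    simp only [ContinuousLinearMap.adjoint_inner_left, ContinuousLinearMap.adjoint_adjoint] at h₁
    rw [pureOp_rankOne, pureOp_rankOne, ← rankOne_htmul, ← inner_ilsOp_pureTensor]
    exact h₁

lemma standardDF_eq_opTrace (ρ : H →L[ℂ] H) {h k : Fin (n + 1) → (H →L[ℂ] H)}
    (hh : ∀ i, IsFiniteRank (h i)) (hk : ∀ i, IsFiniteRank (k i)) :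
    standardDF ρ h k = opTrace (ilsOp n ρ ∘L opTensor (pureOp n h) (pureOp n k)) := by
  obtain ⟨t, ht, ht'⟩ := exists_hasSum_homogeneous ρ hh hk
  rw [standardDF_eq]
  exact ht.tsum_eq.trans ht'.tsum_eq.symm

/-- A homogeneous history of finite rank has factors of finite rank, or has a factor zero. -/
lemma isFiniteRank_or_eq_zero {h : Fin (n + 1) → (H →L[ℂ] H)}
    (hfin : IsFiniteRank (pureOp n h)) : (∀ i, IsFiniteRank (h i)) ∨ ∃ i, h i = 0 := by
  by_contra! hcon
  obtain ⟨⟨i, hi⟩, hne⟩ := hcon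
  have hx : ∀ k, ∃ x, h k x ≠ 0 := fun k => by
    by_contra! hk
    exact hne k (ContinuousLinearMap.ext hk)
  choose x hx using hx
  apply hi
  -- `L` inserts a vector into slot `i` beside nonzero vectors `h k (x k)`. It is injective and
  -- embeds the range of `h i` in that of `pureOp n h`.
  let L : H →ₗ[ℂ] HistSpace H n := (pureTensorL H n).toMultilinearMap.toLinearMap
    (fun k => h k (x k)) i
  have hL : ∀ u, L u = pureTensor n (Function.update (fun k => h k (x k)) i u) := fun u => rfl
  have hinj : Function.Injective L := by
    refine (injective_iff_map_eq_zero L).mpr fun u hu => ?_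
    rw [hL, ← norm_eq_zero, norm_pureTensor, Finset.prod_eq_zero_iff] at hu
    obtain ⟨k, -, hk⟩ := hu
    by_cases hki : k = i
    · subst hki; simpa using hk
    · rw [Function.update_of_ne hki] at hk
      exact absurd (norm_eq_zero.mp hk) (hx k)
  have hle : (LinearMap.range (h i : H →ₗ[ℂ] H)).map L ≤
      LinearMap.range (pureOp n h : HistSpace H n →ₗ[ℂ] HistSpace H n) := by
    rintro _ ⟨_, ⟨y, rfl⟩, rfl⟩
    refine ⟨pureTensor n (Function.update x i y), ?_⟩
    have := pureOp_update_pureTensor h i (h i) (Function.update x i y)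
    rw [Function.update_eq_self, Function.update_self] at this
    refine this.trans ?_
    rw [hL]
    congr 1
    ext k
    by_cases hk : k = i
    · subst hk; simp
    · simp [hk]
  have : FiniteDimensional ℂ
      (LinearMap.range (pureOp n h : HistSpace H n →ₗ[ℂ] HistSpace H n)) := hfin
  have := Submodule.finiteDimensional_of_le hle
  exact Module.Finite.equiv
    (Submodule.equivMapOfInjective L hinj (LinearMap.range (h i : H →ₗ[ℂ] H))).symm

/-- Infinite rank factors can occur only next to a zero factor, and then both sides vanish. -/
lemma standardDF_eq_opTrace_of_isFiniteRank (ρ : H →L[ℂ] H) {h k : Fin (n + 1) → (H →L[ℂ] H)}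
    (hh : IsFiniteRank (pureOp n h)) (hk : IsFiniteRank (pureOp n k)) :
    standardDF ρ h k = opTrace (ilsOp n ρ ∘L opTensor (pureOp n h) (pureOp n k)) := by
  rcases isFiniteRank_or_eq_zero hh with hh' | ⟨i, hi⟩
  · rcases isFiniteRank_or_eq_zero hk with hk' | ⟨i, hi⟩
    · exact standardDF_eq_opTrace ρ hh' hk'
    · have h₁ : prodM H n k = 0 := (prodM H n).map_coord_zero i hi
      have h₂ : pureOp n k = 0 := by
        rw [← Function.update_eq_self i k, hi, pureOp_update_zero]
      simp [standardDF_eq, h₁, h₂, opTensor_zero_right, opTrace]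
  · have h₁ : revProdM H n h = 0 := (revProdM H n).map_coord_zero i hi
    have h₂ : pureOp n h = 0 := by
      rw [← Function.update_eq_self i h, hi, pureOp_update_zero]
    simp [standardDF_eq, h₁, h₂, opTensor_zero_left, opTrace]

end Homogeneous

/-! ### The Gram formula behind positivity and hermitian symmetry. -/

section Gram

/-- For `q = |u⟩⟨v|` the summand is a product of two sequences that are square summable by Bessel's
inequality. -/
lemma summable_inner_isFiniteRank {E κ : Type*} [NormedAddCommGroup E] [InnerProductSpace ℂ E]
    [CompleteSpace E] (A : E →L[ℂ] E) {q : E →L[ℂ] E} (hq : IsFiniteRank q) {x y : κ → E}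
    (hx : Orthonormal ℂ x) (hy : Orthonormal ℂ y) :
    Summable fun i => ⟪A (x i), q (y i)⟫_ℂ := by
  obtain ⟨r, u, v, rfl⟩ := hq.exists_eq_sum
  simp only [sum_apply, InnerProductSpace.rankOne_apply, inner_sum, inner_smul_right]
  refine summable_sum fun k _ => Summable.of_norm_bounded
    ((hy.inner_products_summable (v k)).add (hx.inner_products_summable (A.adjoint (u k))))
    fun i => ?_
  rw [norm_mul, norm_inner_symm, ← ContinuousLinearMap.adjoint_inner_right]
  nlinarith [sq_nonneg (‖⟪y i, v k⟫_ℂ‖ - ‖⟪x i, A.adjoint (u k)⟫_ℂ‖),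
    sq_nonneg ‖⟪y i, v k⟫_ℂ‖, sq_nonneg ‖⟪x i, A.adjoint (u k)⟫_ℂ‖]

variable {H : Type*} [NormedAddCommGroup H] [InnerProductSpace ℂ H] [CompleteSpace H] {n : ℕ}

/-- The product vectors of the chosen orthonormal basis of `H`. -/
def basisTensor (J : Fin (n + 1) → basisIndex H) : HistSpace H n :=
  pureTensor n fun k => chosenBasis H (J k)

lemma orthonormal_basisTensor : Orthonormal ℂ (basisTensor (H := H) (n := n)) := by
  classical
  rw [orthonormal_iff_ite]
  intro j k
  simp only [basisTensor, inner_pureTensor, orthonormal_iff_ite.mp (chosenBasis H).orthonormal,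
    Finset.prod_ite_zero, Finset.prod_const_one, Finset.mem_univ, true_implies, funext_iff]

/-- The multi-indices of a bra vector, split into those of the two summed time slices that the
bra and the ket share, and the remaining ones. -/
def splitIndex (n : ℕ) (ι : Type*) :
    (ι × ι) × ((Fin n → ι) × (Fin n → ι)) ≃ (Fin (n + 1) ⊕ Fin (n + 1) → ι) where
  toFun t := Sum.elim (Fin.snoc (α := fun _ => ι) t.2.1 t.1.2)
    (Fin.cons (α := fun _ => ι) t.1.1 t.2.2)
  invFun j := ((j (.inr 0), j (.inl (Fin.last n))),
    (fun k => j (.inl k.castSucc), fun k => j (.inr k.succ)))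
  left_inv t := by simp
  right_inv j := by
    ext (i | i)
    · induction i using Fin.lastCases <;> simp
    · induction i using Fin.cases <;> simp

/-- The summand of the partial trace of `q` over all but the first and the last tensor factor. -/
def gramTerm (S : H →L[ℂ] H) (q : HistSpace H n →L[ℂ] HistSpace H n)
    (t : basisIndex H × basisIndex H) (i : Fin n → basisIndex H) : ℂ :=
  ⟪pureOp n (Function.update 1 0 S) (basisTensor (Fin.cons (α := fun _ => basisIndex H) t.1 i)),
    q (basisTensor (Fin.snoc (α := fun _ => basisIndex H) i t.2))⟫_ℂ

lemma summable_gramTerm (S : H →L[ℂ] H) {q : HistSpace H n →L[ℂ] HistSpace H n}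
    (hq : IsFiniteRank q) (t : basisIndex H × basisIndex H) : Summable (gramTerm S q t) := by
  refine summable_inner_isFiniteRank _ hq
    (orthonormal_basisTensor.comp (fun i => Fin.cons (α := fun _ => basisIndex H) t.1 i) ?_)
    (orthonormal_basisTensor.comp (fun i => Fin.snoc (α := fun _ => basisIndex H) i t.2) ?_)
  · intro i k h
    exact (Fin.cons_inj.mp h).2
  · intro i k h
    exact (Fin.snoc_inj.mp h).1

/-- The Gram formula for the extended decoherence functional. -/
lemma hasSum_gram {ρ S : H →L[ℂ] H} (hS : S.adjoint = S) (hSS : S ∘L S = ρ)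
    (p q : FinRankProj (HistSpace H n)) :
    HasSum (fun t => conj (∑' i, gramTerm S p.1 t i) * ∑' i, gramTerm S q.1 t i)
      (opTrace (ilsOp n ρ ∘L opTensor p.1 q.1)) := by
  have hp : p.1.adjoint = p.1 := p.2.1.isSelfAdjoint.star_eq
  -- One square root of `ρ` goes to each side of `p ⊗ q`, so that the two sides of each matrix
  -- element can be matched.
  have h : ilsOp n S ∘L (midOp n S).adjoint = ilsOp n ρ := by
    rw [adjoint_midOp, hS, ilsOp, ContinuousLinearMap.comp_assoc, midOp_comp, hSS]
    rfl
  have h₁ := hasSum_opTrace (doubleBasis fun _ => chosenBasis H) h (opTensor_mem p.2.2 q.2.2)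
  rw [← (splitIndex n (basisIndex H)).hasSum_iff] at h₁
  -- For fixed `t`, the `p` part depends only on `i.1` and the `q` part only on `i.2`, so the inner
  -- sum is a product of two absolutely convergent series. Self-adjointness of `p` makes the first
  -- one a conjugate.
  refine h₁.prod_fiberwise fun t => ?_
  have h₂ := ((summable_gramTerm S p.2.2 t).map (starRingEnd ℂ) continuous_star).hasSum.mul
    (summable_gramTerm S q.2.2 t).hasSum (summable_mul_of_summable_norm
      ((summable_gramTerm S p.2.2 t).map (starRingEnd ℂ) continuous_star).norm
      (summable_gramTerm S q.2.2 t).norm)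
  rw [((summable_gramTerm S p.2.2 t).hasSum.map (starRingEnd ℂ) continuous_star).tsum_eq] at h₂
  refine h₂.congr_fun fun i => ?_
  have hb : doubleBasis (fun _ => chosenBasis H) (splitIndex n (basisIndex H) (t, i)) =
      cycBra (chosenBasis H t.1) (chosenBasis H t.2) (fun k => chosenBasis H (i.1 k))
        (fun k => chosenBasis H (i.2 k)) := by
    rw [doubleBasis_apply, doublePure, cycBra]
    congr 2 <;> ext k
    · induction k using Fin.lastCases <;> simp [splitIndex]
    · induction k using Fin.cases <;> simp [splitIndex]
  have hcons : ∀ k : Fin n → basisIndex H,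
      pureOp n (Function.update 1 0 S)
        (basisTensor (Fin.cons (α := fun _ => basisIndex H) t.1 k)) =
        pureTensor n (Fin.cons (α := fun _ => H) (S (chosenBasis H t.1))
          fun m => chosenBasis H (k m)) := fun k => by
    rw [basisTensor, pureOp_pureTensor]
    congr 1
    ext m
    induction m using Fin.cases <;> simp
  have hsnoc : ∀ k : Fin n → basisIndex H,
      basisTensor (Fin.snoc (α := fun _ => basisIndex H) k t.2) =
        pureTensor n (Fin.snoc (α := fun _ => H) (fun m => chosenBasis H (k m))
          (chosenBasis H t.2)) := fun k => by
    rw [basisTensor]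
    congr 1
    ext m
    induction m using Fin.lastCases <;> simp
  simp only [Function.comp_apply, hb]
  rw [midOp_cycBra, ilsOp_cycBra, cycKet, cycBra, opTensor_htmul, inner_htmul, gramTerm, gramTerm,
    hcons, hcons, hsnoc, hsnoc, ← ContinuousLinearMap.adjoint_inner_left, hp, inner_conj_symm]

end Gram

/-! ### Uniqueness of the representing operator. -/

section Uniqueness

variable {H : Type*} [NormedAddCommGroup H] [InnerProductSpace ℂ H] [CompleteSpace H] {n : ℕ}

lemma doublePure_update_add (w : Fin (n + 1) ⊕ Fin (n + 1) → H) (s : Fin (n + 1) ⊕ Fin (n + 1))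
    (u v : H) : doublePure (Function.update w s (u + v)) =
      doublePure (Function.update w s u) + doublePure (Function.update w s v) :=
  (doublePureL H n).map_update_add w s u v

lemma doublePure_update_smul (w : Fin (n + 1) ⊕ Fin (n + 1) → H) (s : Fin (n + 1) ⊕ Fin (n + 1))
    (c : ℂ) (u : H) : doublePure (Function.update w s (c • u)) =
      c • doublePure (Function.update w s u) :=
  (doublePureL H n).map_update_smul w s c u

/-- An operator whose expectation values in product vectors vanish is zero. -/
lemma eq_zero_of_inner_doublePure_self {N : DoubleHistSpace H n →L[ℂ] DoubleHistSpace H n}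
    (h : ∀ w, ⟪doublePure w, N (doublePure w)⟫_ℂ = 0) : N = 0 := by
  -- `t` contains the slots where `w` and `w'` may differ. The induction step polarizes, in slot
  -- `s`, a sesquilinear form whose diagonal vanishes.
  have key : ∀ (t : Finset (Fin (n + 1) ⊕ Fin (n + 1))) (w w' : Fin (n + 1) ⊕ Fin (n + 1) → H),
      (∀ s ∉ t, w s = w' s) → ⟪doublePure w', N (doublePure w)⟫_ℂ = 0 := by
    intro t
    induction t using Finset.induction_on with
    | empty =>
      intro w w' hw
      obtain rfl : w = w' := funext fun s => hw s (Finset.notMem_empty s)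
      exact h w
    | insert s t _ ih =>
      intro w w' hw
      have hu : ∀ u, ⟪doublePure (Function.update w' s u),
          N (doublePure (Function.update w s u))⟫_ℂ = 0 := fun u =>
        ih _ _ fun s' hs' => by
          by_cases hss : s' = s
          · subst hss; simp
          · rw [Function.update_of_ne hss, Function.update_of_ne hss]
            exact hw s' (by simp [hss, hs'])
      have h₁ := hu (w' s + w s)
      have h₂ := hu (w' s + Complex.I • w s)
      have h₃ := hu (w s)
      have h₄ := hu (w' s)
      simp only [Function.update_eq_self] at h₃ h₄
      simp only [doublePure_update_add, doublePure_update_smul, map_add, map_smul, inner_add_left,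
        inner_add_right, inner_smul_left, inner_smul_right, Function.update_eq_self, h₃, h₄,
        Complex.conj_I] at h₁ h₂
      have hI := Complex.I_mul_I
      linear_combination (1 / 2) * h₁ - (1 / 2) * Complex.I * h₂ +
        (1 / 2) * (⟪doublePure w', N (doublePure w)⟫_ℂ -
          ⟪doublePure (Function.update w' s (w s)),
            N (doublePure (Function.update w s (w' s)))⟫_ℂ) * hI
  refine doubleHist_op_ext fun w w' => ?_
  rw [zero_apply, inner_zero_right]
  exact key Finset.univ w w' fun s hs => absurd (Finset.mem_univ s) hs

/-- Unit factors suffice by scaling; they are what makes each `|x⟩⟨x|` a projection in `eq_ilsOp`.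
-/
lemma eq_zero_of_inner_doublePure_unit {N : DoubleHistSpace H n →L[ℂ] DoubleHistSpace H n}
    (h : ∀ w, (∀ s, ‖w s‖ = 1) → ⟪doublePure w, N (doublePure w)⟫_ℂ = 0) : N = 0 := by
  refine eq_zero_of_inner_doublePure_self fun w => ?_
  by_cases hw : ∃ s, w s = 0
  · obtain ⟨s, hs⟩ := hw
    have : doublePure w = 0 := (doublePureL H n).map_coord_zero s hs
    rw [this, inner_zero_left]
  · push Not at hw
    have hsmul : doublePure w = (∏ s, (‖w s‖ : ℂ)) • doublePure fun s => (‖w s‖⁻¹ : ℂ) • w s := by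
      refine Eq.trans ?_ ((doublePureL H n).map_smul_univ (fun s => (‖w s‖ : ℂ))
        fun s => (‖w s‖⁻¹ : ℂ) • w s)
      rw [doublePureL_apply]
      congr 1
      ext s
      have : (‖w s‖ : ℂ) ≠ 0 := by simpa using hw s
      rw [smul_smul, mul_inv_cancel₀ this, one_smul]
    have h0 : ⟪doublePure fun s => (‖w s‖⁻¹ : ℂ) • w s,
        N (doublePure fun s => (‖w s‖⁻¹ : ℂ) • w s)⟫_ℂ = 0 :=
      h _ fun s => norm_smul_inv_norm (hw s)
    rw [hsmul, map_smul, inner_smul_left, inner_smul_right, h0, mul_zero, mul_zero]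

/-- `ilsOp` is the only bounded operator that represents the standard decoherence functional. -/
lemma eq_ilsOp {ρ : H →L[ℂ] H} {M : DoubleHistSpace H n →L[ℂ] DoubleHistSpace H n}
    (hM : ∀ h k : Fin (n + 1) → (H →L[ℂ] H),
      (∀ i, IsStarProjection (h i) ∧ IsFiniteRank (h i)) →
      (∀ i, IsStarProjection (k i) ∧ IsFiniteRank (k i)) →
      standardDF ρ h k = opTrace (M ∘L opTensor (pureOp n h) (pureOp n k))) :
    M = ilsOp n ρ := by
  rw [← sub_eq_zero]
  refine eq_zero_of_inner_doublePure_unit fun w hw => ?_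
  have hP : ∀ x : H, ‖x‖ = 1 → IsStarProjection (InnerProductSpace.rankOne ℂ x x) ∧
      IsFiniteRank (InnerProductSpace.rankOne ℂ x x) := fun x hx =>
    ⟨InnerProductSpace.isStarProjection_rankOne_self hx, isFiniteRank_rankOne x x⟩
  have h := hM (fun i => InnerProductSpace.rankOne ℂ (w (.inl i)) (w (.inl i)))
    (fun i => InnerProductSpace.rankOne ℂ (w (.inr i)) (w (.inr i)))
    (fun i => hP _ (hw _)) (fun i => hP _ (hw _))
  rw [standardDF_eq_opTrace ρ (fun i => isFiniteRank_rankOne _ _)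
    (fun i => isFiniteRank_rankOne _ _), pureOp_rankOne, pureOp_rankOne, ← rankOne_htmul,
    opTrace_comp_rankOne, opTrace_comp_rankOne] at h
  rw [sub_apply, inner_sub_right, sub_eq_zero]
  exact h.symm

end Uniqueness

/-! ### The axioms of a decoherence functional and boundedness. -/

section DecoherenceFunctional

/-- In finite dimension `(a, b) ↦ β (a ⊗ b)` is a continuous bilinear form, and projections have
norm at most one. -/
lemma exists_norm_traceForm_le {E : Type*} [NormedAddCommGroup E] [InnerProductSpace ℂ E]
    [CompleteSpace E] [FiniteDimensional ℂ E] (β : finRankTensor E →ₗ[ℂ] ℂ) :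
    ∃ K : ℝ, ∀ p q : FinRankProj E, ‖β (projTensor p q)‖ ≤ K := by
  have hfin : ∀ a : E →L[ℂ] E, IsFiniteRank a := fun a =>
    FiniteDimensional.finiteDimensional_submodule _
  let B : (E →L[ℂ] E) →ₗ[ℂ] (E →L[ℂ] E) →ₗ[ℂ] ℂ :=
    LinearMap.mk₂ ℂ (fun a b => β ⟨opTensor a b, opTensor_mem (hfin a) (hfin b)⟩)
      (fun a a' b => by rw [← map_add]; congr 1; ext1; exact opTensor_add_left a a' b)
      (fun c a b => by rw [← map_smul]; congr 1; ext1; exact opTensor_smul_left c a b)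
      (fun a b b' => by rw [← map_add]; congr 1; ext1; exact opTensor_add_right a b b')
      (fun c a b => by rw [← map_smul]; congr 1; ext1; exact opTensor_smul_right c a b)
  let B' : (E →L[ℂ] E) →L[ℂ] (E →L[ℂ] E) →L[ℂ] ℂ :=
    LinearMap.toContinuousLinearMap (LinearMap.toContinuousLinearMap.toLinearMap ∘ₗ B)
  refine ⟨‖B'‖, fun p q => ?_⟩
  calc ‖B' p.1 q.1‖ ≤ ‖B'‖ * ‖p.1‖ * ‖q.1‖ := B'.le_opNorm₂ _ _
    _ ≤ ‖B'‖ * 1 * 1 := by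
      gcongr
      exacts [p.2.1.norm_le, q.2.1.norm_le]
    _ = ‖B'‖ := by ring

variable {H : Type*} [NormedAddCommGroup H] [InnerProductSpace ℂ H] [CompleteSpace H] {n : ℕ}

lemma pureOp_one : pureOp n (fun _ => (1 : H →L[ℂ] H)) = 1 :=
  histSpace_clm_ext n fun x => pureOp_pureTensor n _ x

lemma isDecoherenceFunctional_traceForm {ρ : H →L[ℂ] H} (hρ : IsDensityOperator ρ) :
    IsDecoherenceFunctional fun p q : FinRankProj (HistSpace H n) =>
      traceForm (ilsOp n ρ) (projTensor p q) := by
  obtain ⟨S, hS, hSS⟩ := exists_sqrt hρ.isPositive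
  refine ⟨fun p => ?_, fun p q => ?_, fun p hp => ?_, fun p q hp => ?_, fun p p' r q _ hr => ?_⟩
  · have h := hasSum_gram hS hSS p p
    have h' : ∀ t, conj (∑' i, gramTerm S p.1 t i) * ∑' i, gramTerm S p.1 t i =
        ((‖∑' i, gramTerm S p.1 t i‖ ^ 2 : ℝ) : ℂ) := fun t => by
      rw [RCLike.conj_mul]; norm_cast
    simp only [h'] at h
    constructor
    · have h₁ := h.mapL Complex.imCLM
      simp only [Complex.imCLM_apply, Complex.ofReal_im] at h₁
      exact h₁.unique hasSum_zero
    · have h₁ := h.mapL Complex.reCLM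
      simp only [Complex.reCLM_apply, Complex.ofReal_re] at h₁
      exact h₁.nonneg fun t => sq_nonneg _
  · have h := (hasSum_gram hS hSS q p).map (starRingEnd ℂ) continuous_star
    refine (hasSum_gram hS hSS p q).unique (h.congr_fun fun t => ?_)
    simp [mul_comm]
  · have hp' : p.1 = pureOp n fun _ => 1 := hp.trans pureOp_one.symm
    have hfin : IsFiniteRank (pureOp n fun _ => (1 : H →L[ℂ] H)) := hp' ▸ p.2.2
    have h := standardDF_eq_opTrace_of_isFiniteRank ρ hfin hfin
    rw [← hp', standardDF] at h
    refine h.symm.trans ?_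
    simpa using hρ.trace_eq_one
  · have : projTensor p q = 0 := Subtype.ext <| by
      change opTensor p.1 q.1 = 0
      rw [hp, opTensor_zero_left]
    rw [this, map_zero]
  · have : projTensor r q = projTensor p q + projTensor p' q := Subtype.ext <| by
      change opTensor r.1 q.1 = opTensor p.1 q.1 + opTensor p'.1 q.1
      rw [hr, opTensor_add_left]
    rw [this, map_add]

end DecoherenceFunctional

end HistoryQM

end

theorem mainTheorem6 {H : Type*} [NormedAddCommGroup H] [InnerProductSpace ℂ H] [CompleteSpace H]
    (n : ℕ) (ρ : H →L[ℂ] H) (hρ : IsDensityOperator ρ) :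
    ∃ (d : FinRankProj (HistSpace H n) → FinRankProj (HistSpace H n) → ℂ)
      (β : finRankTensor (HistSpace H n) →ₗ[ℂ] ℂ)
      (S : DoubleHistSpace H n →L⋆[ℂ] DoubleHistSpace H n →L[ℂ] ℂ)
      (X : DoubleHistSpace H n →L[ℂ] DoubleHistSpace H n),
      -- `d` extends the standard decoherence functional on homogeneous histories
      (∀ h k : Fin (n + 1) → (H →L[ℂ] H),
        (∀ i, IsStarProjection (h i)) → (∀ i, IsStarProjection (k i)) →
        ∀ p q : FinRankProj (HistSpace H n), p.1 = pureOp n h → q.1 = pureOp n k →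
          d p q = standardDF ρ h k) ∧
      -- `d`, `S`, `X` are given by the ILS series, for every choice of the orthonormal bases
      (∀ (ι : Type*) (D : ILSData ρ n ι),
        (∀ p q, HasSum (fun j => D.coeff j * ⟪D.bra j, opTensor p.1 q.1 (D.ket j)⟫_ℂ) (d p q)) ∧
        (∀ ξ η, HasSum (fun j => D.coeff j * (⟪D.bra j, ξ⟫_ℂ * ⟪η, D.ket j⟫_ℂ)) (S η ξ)) ∧
        (∀ ξ, HasSum (fun j => (D.coeff j * ⟪D.bra j, ξ⟫_ℂ) • D.ket j) (X ξ))) ∧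
      -- `S` is bounded by one, and `X` is its operator
      (∀ ξ η, ‖S η ξ‖ ≤ ‖ξ‖ * ‖η‖) ∧
      (∀ ξ η, S η ξ = ⟪η, X ξ⟫_ℂ) ∧
      -- `d` is tracially bounded, its functional `β` being given by `S`
      IsTraciallyBounded d ∧
      IsAssociated d β ∧
      (∀ ξ η : HistSpace H n ⊗[ℂ] HistSpace H n, β (ketBra ξ η) = S η ξ) ∧
      (∀ ξ : HistSpace H n ⊗[ℂ] HistSpace H n, ‖ξ‖ = 1 → ‖β (ketBra ξ ξ)‖ ≤ 1) ∧
      -- pseudo-ILS representation by `X`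
      (∀ p q : FinRankProj (HistSpace H n), IsTraceClass (X ∘L opTensor p.1 q.1) ∧
        d p q = opTrace (X ∘L opTensor p.1 q.1)) ∧
      -- `X` is the only bounded operator that represents the standard decoherence functional
      (∀ M : DoubleHistSpace H n →L[ℂ] DoubleHistSpace H n,
        (∀ h k : Fin (n + 1) → (H →L[ℂ] H),
          (∀ i, IsStarProjection (h i) ∧ IsFiniteRank (h i)) →
          (∀ i, IsStarProjection (k i) ∧ IsFiniteRank (k i)) →
          standardDF ρ h k = opTrace (M ∘L opTensor (pureOp n h) (pureOp n k))) → M = X) ∧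
      -- `X` is not trace class in infinite dimensions
      (¬ FiniteDimensional ℂ H → ¬ IsTraceClass X) := by
  have hX : ∀ ξ : DoubleHistSpace H n, ‖ilsOp n ρ ξ‖ ≤ ‖ξ‖ :=
    norm_ilsOp_apply_le hρ.norm_le_one
  have hS : ∀ ξ η : DoubleHistSpace H n, ‖⟪η, ilsOp n ρ ξ⟫_ℂ‖ ≤ ‖ξ‖ * ‖η‖ := fun ξ η =>
    (norm_inner_le_norm _ _).trans <| by
      rw [mul_comm]; exact mul_le_mul_of_nonneg_right (hX ξ) (norm_nonneg _)
  have hβ : ∀ ξ η : HistSpace H n ⊗[ℂ] HistSpace H n, traceForm (ilsOp n ρ) (ketBra ξ η) =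
      ⟪(η : DoubleHistSpace H n), ilsOp n ρ (ξ : DoubleHistSpace H n)⟫_ℂ := fun ξ η =>
    opTrace_comp_rankOne _ _ _
  have hβ1 : ∀ ξ : HistSpace H n ⊗[ℂ] HistSpace H n, ‖ξ‖ = 1 →
      ‖traceForm (ilsOp n ρ) (ketBra ξ ξ)‖ ≤ 1 := fun ξ hξ => by
    rw [hβ]
    refine (hS _ _).trans ?_
    rw [UniformSpace.Completion.norm_coe, hξ, one_mul]
  -- `S η = ⟪η, ·⟫ ∘ X`, so the conjugate linear variable comes first.
  let S : DoubleHistSpace H n →L⋆[ℂ] DoubleHistSpace H n →L[ℂ] ℂ :=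
    ((ContinuousLinearMap.compL ℂ (DoubleHistSpace H n) (DoubleHistSpace H n) ℂ).flip
      (ilsOp n ρ)) ∘SL innerSL ℂ
  refine ⟨fun p q => traceForm (ilsOp n ρ) (projTensor p q), traceForm (ilsOp n ρ), S, ilsOp n ρ,
    ?_, ?_, hS, fun ξ η => rfl, ⟨isDecoherenceFunctional_traceForm hρ, ?_, ?_⟩, fun p q => rfl,
    hβ, hβ1, fun p q => ⟨isTraceClass_comp_opTensor _ p q, rfl⟩, fun M hM => eq_ilsOp hM,
    not_isTraceClass_ilsOp hρ.ne_zero⟩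
  · intro h k _ _ p q hp hq
    have := standardDF_eq_opTrace_of_isFiniteRank ρ (hp ▸ p.2.2) (hq ▸ q.2.2)
    rw [← hp, ← hq] at this
    exact this.symm
  · intro ι D
    have hket : ∀ ξ, HasSum (fun j => (D.coeff j * ⟪D.bra j, ξ⟫_ℂ) • D.ket j) (ilsOp n ρ ξ) :=
      fun ξ => by
        have h := (HilbertBasis.hasSum_repr
          (doubleBasis fun s => D.e (braEquiv n s)) ξ).mapL (ilsOp n ρ)
        simp only [HilbertBasis.repr_apply_apply, map_smul] at h
        rw [← D.hasSum_iff (fun b => ⟪b, ξ⟫_ℂ • ilsOp n ρ b)] at h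
        simpa only [D.ilsOp_bra, smul_smul, mul_comm] using h
    refine ⟨fun p q => ?_, fun ξ η => ?_, hket⟩
    · have h := hasSum_opTrace (doubleBasis fun s => D.e (braEquiv n s)) (P := 1)
        (Q := ilsOp n ρ) (X := ilsOp n ρ) (by
          rw [← ContinuousLinearMap.star_eq_adjoint, star_one]; rfl)
        (opTensor_mem p.2.2 q.2.2)
      have h' := (D.hasSum_iff (fun b => ⟪b, opTensor p.1 q.1 (ilsOp n ρ b)⟫_ℂ) _).mpr h
      simp only [D.ilsOp_bra, map_smul, inner_smul_right] at h'
      exact h'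
    · have h := (hket ξ).mapL (innerSL ℂ η)
      simp only [innerSL_apply_apply, inner_smul_right, mul_assoc] at h
      exact h
  · intro hfin
    exact exists_norm_traceForm_le _
  · exact ⟨traceForm (ilsOp n ρ), fun p q => rfl, 1, hβ1⟩
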